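/- For integers $m,n\ge 0$, an $(m,n)$-graph is a finite graph with $m$ types (colours) of arcs and $n$ types of edges whose underlying undirected graph $\mathrm{und}(G)$ is simple. A homomorphism $G\to H$ of $(m,n)$-graphs is a vertex map that sends every arc (edge) of $G$ to an arc (edge) of $H$ of the same type and, for arcs, the same direction; $\chi_{m,n}(G)$ is the least number of vertices of an $(m,n)$-graph $H$ with $G\to H$. An $(m,n)$-relative clique of $G$ is a set $R\subseteq V(G)$ such that distinct vertices of $R$ have distinct images under every homomorphism of $G$ to every $(m,n)$-graph; $\omega_{r(m,n)}(G)$ is the maximum of $|R|$ over all such $R$. An $(m,n)$-absolute clique is an $(m,n)$-graph $A$ with $\chi_{m,n}(A)=|V(A)|$; $\omega_{a(m,n)}(G)$ is the maximum of $|V(A)|$ over all subgraphs $A$ of $G$ that are $(m,n)$-absolute cliques. Let $\mathcal G_3$ be the family of finite simple graphs of maximum degree at most $3$ (subcubic graphs), and for $p\in\{\omega_{a(m,n)},\omega_{r(m,n)}\}$ let $p(\mathcal G_3)=\max\{p(G):\mathrm{und}(G)\in\mathcal G_3\}$. Theorem. The following maxima exist and have the stated values. (i) $\omega_{a(1,0)}(\mathcal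 G_3)=\omega_{r(1,0)}(\mathcal G_3)=7$. (ii) $\omega_{a(0,n)}(\mathcal G_3)=\omega_{r(0,n)}(\mathcal G_3)=8$ for $n=2,3$. (iii) $\omega_{a(m,n)}(\mathcal G_3)=\omega_{r(m,n)}(\mathcal G_3)=10$ for $(m,n)=(1,1)$ and for all $(m,n)$ with $2m+n\ge 4$. -/

import Mathlib

/-- The ways in which a vertex `v` can be adjacent to a vertex `u` in an `(m, n)`-graph, seen
from `u`: by an arc of colour `i` from `u` to `v`, by an arc of colour `i` from `v` to `u`, or by
an (undirected) edge of colour `j`. These are the `2m + n` values `1, …, m`, `-1, …, -m` and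
`m + 1, …, m + n` of the labelling `σ`. -/
inductive AdjType (m n : ℕ) : Type
  | fwd (i : Fin m) : AdjType m n
  | bwd (i : Fin m) : AdjType m n
  | edge (j : Fin n) : AdjType m n
deriving DecidableEq

/-- The adjacency type seen from the other end: arcs change sign, edges do not. -/
def AdjType.rev {m n : ℕ} : AdjType m n → AdjType m n
  | .fwd i => .bwd i
  | .bwd i => .fwd i
  | .edge j => .edge j

/-- An `(m, n)`-coloured mixed graph on the vertex set `V` whose underlying graph is simple:
`G.label u v` is `none` if `u` and `v` are not adjacent, and otherwise it is the label
`σ(uv)`. -/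
structure MNGraph (m n : ℕ) (V : Type) where
  label : V → V → Option (AdjType m n)
  label_self : ∀ u, label u u = none
  label_rev : ∀ u v, label v u = (label u v).map AdjType.rev

namespace MNGraph

/-- The underlying undirected simple graph. -/
def und {m n : ℕ} {V : Type} (G : MNGraph m n V) : SimpleGraph V where
  Adj u v := G.label u v ≠ none
  symm := ⟨fun u v h => by rw [G.label_rev u v]; simpa using h⟩
  loopless := ⟨fun u h => h (G.label_self u)⟩

/-- `f` is a homomorphism of `G` to `H`: it maps every arc (edge) to an arc (edge) of the same
label and direction. -/
def IsHom {m n : ℕ} {V W : Type} (G : MNGraph m n V) (H : MNGraph m n W) (f : V → W) : Prop :=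
  ∀ u v t, G.label u v = some t → H.label (f u) (f v) = some t

/-- The `(m, n)`-chromatic number of a finite `(m, n)`-graph `G`: the least order of a finite
`(m, n)`-graph `H` with `G → H`. -/
noncomputable def chromaticNumber {m n : ℕ} {V : Type} (G : MNGraph m n V) : ℕ :=
  sInf {k | ∃ (W : Type) (_ : Finite W) (H : MNGraph m n W),
    (∃ f : V → W, G.IsHom H f) ∧ Nat.card W = k}

/-- `R` is an `(m, n)`-relative clique of `G`: distinct vertices of `R` have distinct images under
every homomorphism of `G` to every (finite) `(m, n)`-graph. -/
def IsRelativeClique {m n : ℕ} {V : Type} (G : MNGraph m n V) (R : Finset V) : Prop :=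
  ∀ (W : Type) (_ : Finite W) (H : MNGraph m n W) (f : V → W), G.IsHom H f →
    ∀ u ∈ R, ∀ v ∈ R, u ≠ v → f u ≠ f v

/-- `A` is an `(m, n)`-absolute clique: its `(m, n)`-chromatic number is its order. -/
def IsAbsoluteClique {m n : ℕ} {V : Type} (A : MNGraph m n V) : Prop :=
  A.chromaticNumber = Nat.card V

/-- `A`, with vertex set `S ⊆ V`, is a (not necessarily induced) subgraph of `G`: every arc or
edge of `A` is an arc or edge of `G` with the same label. -/
def IsSubgraph {m n : ℕ} {V : Type} {S : Finset V} (A : MNGraph m n {v // v ∈ S})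
    (G : MNGraph m n V) : Prop :=
  ∀ u v t, A.label u v = some t → G.label u v = some t

/-- The orders of the relative cliques of `G`. -/
def relativeCliqueOrders {m n : ℕ} {V : Type} (G : MNGraph m n V) : Set ℕ :=
  {k | ∃ R : Finset V, G.IsRelativeClique R ∧ R.card = k}

/-- The orders of the subgraphs of `G` that are absolute cliques. -/
def absoluteCliqueOrders {m n : ℕ} {V : Type} (G : MNGraph m n V) : Set ℕ :=
  {k | ∃ (S : Finset V) (A : MNGraph m n {v // v ∈ S}),
    A.IsSubgraph G ∧ A.IsAbsoluteClique ∧ S.card = k}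

/-- The `(m, n)`-relative clique number of a finite `(m, n)`-graph. -/
noncomputable def relativeCliqueNumber {m n : ℕ} {V : Type} (G : MNGraph m n V) : ℕ :=
  sSup G.relativeCliqueOrders

/-- The `(m, n)`-absolute clique number of a finite `(m, n)`-graph. -/
noncomputable def absoluteCliqueNumber {m n : ℕ} {V : Type} (G : MNGraph m n V) : ℕ :=
  sSup G.absoluteCliqueOrders

/-- For a finite graph the relative clique number is a maximum. -/
theorem isGreatest_relativeCliqueNumber {m n : ℕ} {V : Type} [Finite V] (G : MNGraph m n V) :
    IsGreatest G.relativeCliqueOrders G.relativeCliqueNumber := by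
  have hne : G.relativeCliqueOrders.Nonempty :=
    ⟨0, ∅, fun W _ H f _ u hu => absurd hu (Finset.notMem_empty u), Finset.card_empty⟩
  have hb : BddAbove G.relativeCliqueOrders := by
    refine ⟨Nat.card V, ?_⟩
    rintro k ⟨R, -, rfl⟩
    simpa using Set.ncard_le_card (R : Set V)
  exact ⟨Nat.sSup_mem hne hb, fun k hk => le_csSup hb hk⟩

/-- For a finite graph the absolute clique number is a maximum. -/
theorem isGreatest_absoluteCliqueNumber {m n : ℕ} {V : Type} [Finite V] (G : MNGraph m n V) :
    IsGreatest G.absoluteCliqueOrders G.absoluteCliqueNumber := by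
  have hne : G.absoluteCliqueOrders.Nonempty := by
    have hE : IsEmpty {v : V // v ∈ (∅ : Finset V)} := ⟨fun x => Finset.notMem_empty _ x.2⟩
    refine ⟨0, ∅, ⟨fun _ _ => none, fun _ => rfl, fun _ _ => rfl⟩, ?_, ?_, Finset.card_empty⟩
    · intro u
      exact hE.elim u
    · unfold IsAbsoluteClique chromaticNumber
      rw [Nat.card_of_isEmpty]
      apply Nat.sInf_eq_zero.mpr
      left
      exact ⟨Empty, inferInstance, ⟨fun _ _ => none, fun _ => rfl, fun _ _ => rfl⟩,
        ⟨fun x => hE.elim x, fun u => hE.elim u⟩, by simp⟩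
  have hb : BddAbove G.absoluteCliqueOrders := by
    refine ⟨Nat.card V, ?_⟩
    rintro k ⟨S, -, -, -, rfl⟩
    simpa using Set.ncard_le_card (S : Set V)
  exact ⟨Nat.sSup_mem hne hb, fun k hk => le_csSup hb hk⟩

end MNGraph

/-- The family of simple graphs with maximum degree at most `Δ`. -/
def MaxDegreeLE (Δ : ℕ) (V : Type) (U : SimpleGraph V) : Prop :=
  ∀ v, (U.neighborSet v).encard ≤ Δ

/-- `ω_{a(m,n)}(F) = k`: the number `k` is the maximum of the absolute clique numbers of the finite
`(m, n)`-graphs whose underlying graph belongs to the family `F`. -/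
def FamilyAbsoluteCliqueNumberEq (m n : ℕ) (F : ∀ V : Type, SimpleGraph V → Prop) (k : ℕ) : Prop :=
  IsGreatest {a | ∃ (V : Type) (_ : Finite V) (G : MNGraph m n V),
    F V G.und ∧ G.absoluteCliqueNumber = a} k

/-- `ω_{r(m,n)}(F) = k`: the number `k` is the maximum of the relative clique numbers of the finite
`(m, n)`-graphs whose underlying graph belongs to the family `F`. -/
def FamilyRelativeCliqueNumberEq (m n : ℕ) (F : ∀ V : Type, SimpleGraph V → Prop) (k : ℕ) : Prop :=
  IsGreatest {a | ∃ (V : Type) (_ : Finite V) (G : MNGraph m n V),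
    F V G.und ∧ G.relativeCliqueNumber = a} k

/-! A homomorphism can identify two distinct vertices exactly when they are non-adjacent and every
common neighbour is attached to both in the same way. So a relative clique is a set whose vertices
pairwise satisfy `Sees`, and a graph all of whose vertices see each other is an absolute clique.
Since absolute cliques give relative cliques of the same order, each value needs only an upper bound
for pairwise seeing sets and one graph that attains it (`family_cliqueNumber_eq`).

Vertices that see each other are at distance at most two, so the Moore bound 1 + 3 + 6 = 10 always
applies. The Petersen graph attains it as soon as the labels around each vertex can be made
distinct.

With at most three edge colours and no arcs, nine pairwise seeing vertices are impossible
(`card_ne_nine_of_colSees`). By parity some edge leaves the set, and then the near-equality in the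
Moore bound forces the Petersen graph minus a vertex, properly coloured. In such a 3-colouring each
colour would be missed by an odd number of the nine vertices, hence by exactly one of the three
vertices of degree two, and it would extend to the Petersen graph, which is not 3-edge-colourable.

With a single arc colour, eight pairwise seeing vertices are impossible
(`card_ne_eight_of_dirSees`). A weighted count shows that they would be cubic with every pair joined
in exactly one way; so they would span a triangle-free cubic graph of diameter two, which is the
Wagner graph, and no orientation of it works. -/

namespace MNGraph

/-! ### Seeing, homomorphisms and cliques -/

/-- `u` and `v` are adjacent, or they are adjacent to a common vertex in different ways. -/
def Sees {m n : ℕ} {V : Type} (G : MNGraph m n V) (u v : V) : Prop :=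
  G.label u v ≠ none ∨
    ∃ w, G.label w u ≠ none ∧ G.label w v ≠ none ∧ G.label w u ≠ G.label w v

theorem label_ne_none_symm {m n : ℕ} {V : Type} (G : MNGraph m n V) {u v : V}
    (h : G.label u v ≠ none) : G.label v u ≠ none := by
  rw [G.label_rev u v]; simpa using h

theorem IsHom.injective_of_sees {m n : ℕ} {V W : Type} {G : MNGraph m n V} {H : MNGraph m n W}
    {f : V → W} (hf : G.IsHom H f) {u v : V} (h : G.Sees u v) : f u ≠ f v := by
  intro he
  rcases h with h | ⟨w, hu, hv, hne⟩
  · obtain ⟨t, ht⟩ := Option.ne_none_iff_exists'.mp h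
    have := hf u v t ht
    rw [he, H.label_self] at this
    cases this
  · obtain ⟨t, ht⟩ := Option.ne_none_iff_exists'.mp hu
    obtain ⟨s, hs⟩ := Option.ne_none_iff_exists'.mp hv
    have h1 := hf w u t ht
    have h2 := hf w v s hs
    rw [he, h2] at h1
    exact hne (by rw [ht, hs, h1])

/-- The graph obtained by identifying two vertices that do not see each other (the vertex `v` is
left isolated). -/
def identify {m n : ℕ} {V : Type} [DecidableEq V] (G : MNGraph m n V) (u v : V) :
    MNGraph m n V where
  label a b :=
    if a = v ∨ b = v then none
    else if a = u then (if b = u then none else (G.label u b).or (G.label v b))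
    else if b = u then (G.label a u).or (G.label a v)
    else G.label a b
  label_self a := by
    have := G.label_self a
    split_ifs <;> simp_all
  label_rev a b := by
    have h1 := G.label_rev a b
    have h2 := G.label_rev u a
    have h3 := G.label_rev v a
    have h4 := G.label_rev b u
    have h5 := G.label_rev b v
    by_cases h : a = v ∨ b = v
    · rw [if_pos h, if_pos h.symm]; rfl
    · rw [if_neg h, if_neg (fun h' => h h'.symm)]
      split_ifs with hb ha ha
      · rfl
      · rw [G.label_rev a u, G.label_rev a v, Option.map_or]
      · rw [G.label_rev u b, G.label_rev v b, Option.map_or]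
      · exact h1

/-- Wherever the labels towards `u` and `v` are both present they agree, so taking whichever exists
loses no information. -/
theorem identify_isHom {m n : ℕ} {V : Type} [DecidableEq V] (G : MNGraph m n V) {u v : V}
    (huv : u ≠ v) (h : ¬ G.Sees u v) :
    G.IsHom (G.identify u v) (fun x => if x = v then u else x) := by
  have hadj : G.label u v = none := by
    by_contra h'; exact h (Or.inl h')
  have hadj' : G.label v u = none := by rw [G.label_rev u v, hadj]; rfl
  have key : ∀ w t s, G.label w u = some t → G.label w v = some s → t = s := by
    intro w t s ht hs
    by_contra hne
    exact h (Or.inr ⟨w, by simp [ht], by simp [hs], by simpa [ht, hs] using hne⟩)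
  have key' : ∀ w t s, G.label u w = some t → G.label v w = some s → t = s := by
    intro w t s ht hs
    by_contra hne
    refine h (Or.inr ⟨w, G.label_ne_none_symm (by simp [ht]), G.label_ne_none_symm (by simp [hs]), ?_⟩)
    rw [G.label_rev u w, G.label_rev v w, ht, hs]
    cases t <;> cases s <;> simp_all [AdjType.rev]
  intro a b t hab
  have hself := G.label_self
  have or1 : ∀ w, G.label w v = some t → (G.label w u).or (G.label w v) = some t := by
    intro w hw
    cases h1 : G.label w u with
    | none => simpa using hw
    | some s => simpa using key w s t h1 hw
  have or2 : ∀ w, G.label v w = some t → (G.label u w).or (G.label v w) = some t := by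
    intro w hw
    cases h1 : G.label u w with
    | none => simpa using hw
    | some s => simpa using key' w s t h1 hw
  simp only [identify]
  by_cases ha : a = v
  · subst ha
    have hb : b ≠ a := by rintro rfl; simp [hself] at hab
    have hbu : b ≠ u := by rintro rfl; simp [hadj'] at hab
    simp [hb, huv, hbu, or2 b hab]
  · by_cases hb : b = v
    · subst hb
      have hau : a ≠ u := by rintro rfl; simp [hadj] at hab
      simp [ha, huv, hau, or1 a hab]
    · by_cases hau : a = u
      · subst hau
        have hbu : b ≠ a := by rintro rfl; simp [hself] at hab
        simp [hb, huv, hbu, hab]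
      · by_cases hbu : b = u
        · subst hbu
          simp [ha, huv, hau, hab]
        · simp [ha, hb, hau, hbu, hab]

theorem isRelativeClique_iff {m n : ℕ} {V : Type} [Finite V] (G : MNGraph m n V) (R : Finset V) :
    G.IsRelativeClique R ↔ ∀ u ∈ R, ∀ v ∈ R, u ≠ v → G.Sees u v := by
  classical
  constructor
  · intro h u hu v hv huv
    by_contra hs
    refine h V inferInstance (G.identify u v) _ (G.identify_isHom huv hs) u hu v hv huv ?_
    simp
  · intro h W _ H f hf u hu v hv huv
    exact hf.injective_of_sees (h u hu v hv huv)

/-- The image of `f`, with the labels of the target, is itself a target; minimality of the order of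
`A` forbids it to be smaller than `V`. -/
theorem IsAbsoluteClique.injective {m n : ℕ} {V W : Type} [Finite V] {A : MNGraph m n V}
    (hA : A.IsAbsoluteClique) {H : MNGraph m n W} {f : V → W} (hf : A.IsHom H f) :
    Function.Injective f := by
  have hle : Nat.card V ≤ Nat.card (Set.range f) := by
    rw [← hA]
    refine Nat.sInf_le ⟨Set.range f, inferInstance,
      ⟨fun a b => H.label a b, fun a => H.label_self a, fun a b => H.label_rev a b⟩,
      ⟨Set.rangeFactorization f, fun u v t h => hf u v t h⟩, rfl⟩
  have hsurj : Function.Surjective (Set.rangeFactorization f) := Set.rangeFactorization_surjective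
  have hbij := (Nat.bijective_iff_surjective_and_card (Set.rangeFactorization f)).mpr
    ⟨hsurj, le_antisymm hle (Nat.card_le_card_of_surjective _ hsurj)⟩
  intro a b hab
  exact hbij.1 (Subtype.ext hab)

theorem isAbsoluteClique_of_sees {m n : ℕ} {V : Type} [Finite V] {A : MNGraph m n V}
    (h : ∀ u v, u ≠ v → A.Sees u v) : A.IsAbsoluteClique := by
  apply le_antisymm
  · exact Nat.sInf_le ⟨V, inferInstance, A, ⟨id, fun u v t h => h⟩, rfl⟩
  · refine le_csInf ⟨_, V, inferInstance, A, ⟨id, fun u v t h => h⟩, rfl⟩ ?_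
    rintro k ⟨W, _, H, ⟨f, hf⟩, rfl⟩
    refine Nat.card_le_card_of_injective f fun a b hab => ?_
    by_contra hne
    exact hf.injective_of_sees (h a b hne) hab

theorem absoluteCliqueOrders_subset {m n : ℕ} {V : Type} [Finite V] (G : MNGraph m n V) :
    G.absoluteCliqueOrders ⊆ G.relativeCliqueOrders := by
  rintro k ⟨S, A, hsub, hA, rfl⟩
  refine ⟨S, fun W _ H f hf u hu v hv huv he => huv ?_, rfl⟩
  have hAf : A.IsHom H (fun x => f x) := fun a b t hab => hf a b t (hsub a b t hab)
  exact congrArg Subtype.val (hA.injective hAf (a₁ := ⟨u, hu⟩) (a₂ := ⟨v, hv⟩) he)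

theorem card_mem_absoluteCliqueOrders {m n : ℕ} {V : Type} [Finite V] (G : MNGraph m n V)
    (h : ∀ u v, u ≠ v → G.Sees u v) : Nat.card V ∈ G.absoluteCliqueOrders := by
  classical
  have := Fintype.ofFinite V
  refine ⟨Finset.univ,
    ⟨fun a b => G.label a b, fun a => G.label_self a, fun a b => G.label_rev a b⟩,
    fun u v t h => h, isAbsoluteClique_of_sees ?_, by simp⟩
  intro u v huv
  rcases h u v (fun he => huv (Subtype.ext he)) with h | ⟨w, hw⟩
  · exact Or.inl h
  · exact Or.inr ⟨⟨w, Finset.mem_univ w⟩, hw⟩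

end MNGraph

open MNGraph

/-- The upper bound is needed only for relative cliques and the example only for absolute ones,
because every absolute clique order is a relative clique order. -/
theorem family_cliqueNumber_eq (m n k : ℕ) (F : ∀ V : Type, SimpleGraph V → Prop)
    (upper : ∀ (V : Type) (_ : Finite V) (G : MNGraph m n V), F V G.und → ∀ R : Finset V,
      (∀ u ∈ R, ∀ v ∈ R, u ≠ v → G.Sees u v) → R.card ≤ k)
    (lower : ∃ (V : Type) (_ : Finite V) (G : MNGraph m n V), F V G.und ∧
      (∀ u v, u ≠ v → G.Sees u v) ∧ Nat.card V = k) :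
    FamilyAbsoluteCliqueNumberEq m n F k ∧ FamilyRelativeCliqueNumberEq m n F k := by
  have hr : ∀ (V : Type) (_ : Finite V) (G : MNGraph m n V), F V G.und →
      ∀ a ∈ G.relativeCliqueOrders, a ≤ k := by
    rintro V _ G hG a ⟨R, hR, rfl⟩
    exact upper V inferInstance G hG R ((G.isRelativeClique_iff R).mp hR)
  have ha : ∀ (V : Type) (_ : Finite V) (G : MNGraph m n V), F V G.und →
      ∀ a ∈ G.absoluteCliqueOrders, a ≤ k :=
    fun V hV G hG a h => hr V hV G hG a (G.absoluteCliqueOrders_subset h)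
  obtain ⟨V, _, G, hG, hs, hk⟩ := lower
  have hmem : k ∈ G.absoluteCliqueOrders := hk ▸ G.card_mem_absoluteCliqueOrders hs
  refine ⟨⟨⟨V, inferInstance, G, hG, ?_⟩, ?_⟩, ⟨⟨V, inferInstance, G, hG, ?_⟩, ?_⟩⟩
  · exact le_antisymm (ha V inferInstance G hG _ G.isGreatest_absoluteCliqueNumber.1)
      (G.isGreatest_absoluteCliqueNumber.2 hmem)
  · rintro a ⟨V', _, G', hG', rfl⟩
    exact ha V' inferInstance G' hG' _ G'.isGreatest_absoluteCliqueNumber.1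
  · exact le_antisymm (hr V inferInstance G hG _ G.isGreatest_relativeCliqueNumber.1)
      (G.isGreatest_relativeCliqueNumber.2 (G.absoluteCliqueOrders_subset hmem))
  · rintro a ⟨V', _, G', hG', rfl⟩
    exact hr V' inferInstance G' hG' _ G'.isGreatest_relativeCliqueNumber.1

/-! ### More colours, and the extremal examples -/

/-- The inclusion of label sets when there are more colours. -/
def AdjType.castLE {m₀ n₀ m n : ℕ} (hm : m₀ ≤ m) (hn : n₀ ≤ n) : AdjType m₀ n₀ → AdjType m n
  | .fwd i => .fwd (Fin.castLE hm i)
  | .bwd i => .bwd (Fin.castLE hm i)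
  | .edge j => .edge (Fin.castLE hn j)

theorem AdjType.castLE_injective {m₀ n₀ m n : ℕ} (hm : m₀ ≤ m) (hn : n₀ ≤ n) :
    Function.Injective (AdjType.castLE hm hn) := by
  intro a b h
  cases a <;> cases b <;> simp_all [AdjType.castLE]

namespace MNGraph

/-- An `(m₀, n₀)`-graph as an `(m, n)`-graph. -/
def castLE {m₀ n₀ m n : ℕ} {V : Type} (hm : m₀ ≤ m) (hn : n₀ ≤ n) (G : MNGraph m₀ n₀ V) :
    MNGraph m n V where
  label u v := (G.label u v).map (AdjType.castLE hm hn)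
  label_self u := by simp [G.label_self]
  label_rev u v := by
    rw [G.label_rev u v, Option.map_map, Option.map_map]
    congr 1
    funext t
    cases t <;> rfl

theorem castLE_sees {m₀ n₀ m n : ℕ} {V : Type} (hm : m₀ ≤ m) (hn : n₀ ≤ n)
    (G : MNGraph m₀ n₀ V) {u v : V} (h : G.Sees u v) : (G.castLE hm hn).Sees u v := by
  rcases h with h | ⟨w, h1, h2, h3⟩
  · left; simpa [castLE] using h
  · refine Or.inr ⟨w, by simpa [castLE] using h1, by simpa [castLE] using h2, fun he => h3 ?_⟩
    exact Option.map_injective (AdjType.castLE_injective hm hn) he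

/-- The label function given by a list of labelled arcs and edges. -/
def labelOfList {m n N : ℕ} (L : List ((Fin N × Fin N) × AdjType m n)) (u v : Fin N) :
    Option (AdjType m n) :=
  (L.lookup (u, v)).or ((L.lookup (v, u)).map AdjType.rev)

/-- The hypotheses are finite checks for the smallest colour counts; an injective change of labels
preserves both seeing and the underlying graph, which covers all larger counts. -/
theorem exists_clique_of_list {m n N : ℕ} (L : List ((Fin N × Fin N) × AdjType m n))
    (h0 : ∀ u, labelOfList L u u = none)
    (h1 : ∀ u v, labelOfList L v u = (labelOfList L u v).map AdjType.rev)
    (h2 : ∀ u, (Finset.univ.filter fun v => labelOfList L u v ≠ none).card ≤ 3)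
    (h3 : ∀ u v, u ≠ v → labelOfList L u v ≠ none ∨ ∃ w, labelOfList L w u ≠ none ∧
      labelOfList L w v ≠ none ∧ labelOfList L w u ≠ labelOfList L w v)
    {m' n' : ℕ} (hm : m ≤ m') (hn : n ≤ n') :
    ∃ (V : Type) (_ : Finite V) (G : MNGraph m' n' V), MaxDegreeLE 3 V G.und ∧
      (∀ u v, u ≠ v → G.Sees u v) ∧ Nat.card V = N := by
  let G : MNGraph m n (Fin N) := ⟨labelOfList L, h0, h1⟩
  refine ⟨Fin N, inferInstance, G.castLE hm hn, fun u => ?_,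
    fun u v huv => G.castLE_sees hm hn (h3 u v huv), by simp⟩
  have : (G.castLE hm hn).und.neighborSet u =
      ((Finset.univ.filter fun v => labelOfList L u v ≠ none : Finset (Fin N)) : Set (Fin N)) := by
    ext v
    simp [und, castLE, G]
  rw [this, Set.encard_coe_eq_coe_finsetCard]
  exact_mod_cast h2 u

theorem exists_oriented_clique {m n : ℕ} (hm : 1 ≤ m) :
    ∃ (V : Type) (_ : Finite V) (G : MNGraph m n V), MaxDegreeLE 3 V G.und ∧
      (∀ u v, u ≠ v → G.Sees u v) ∧ Nat.card V = 7 :=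
  exists_clique_of_list (m := 1) (n := 0) (N := 7)
    ([(0, 4), (1, 0), (2, 0), (2, 1), (3, 2), (4, 6), (5, 1), (5, 3), (6, 3), (6, 5)].map
      fun e => (e, .fwd 0))
    (by decide +kernel) (by decide +kernel) (by decide +kernel) (by decide +kernel) hm n.zero_le

/-- The Wagner graph with rim edges coloured alternately. -/
theorem exists_two_edge_coloured_clique {m n : ℕ} (hn : 2 ≤ n) :
    ∃ (V : Type) (_ : Finite V) (G : MNGraph m n V), MaxDegreeLE 3 V G.und ∧
      (∀ u v, u ≠ v → G.Sees u v) ∧ Nat.card V = 8 :=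
  exists_clique_of_list (m := 0) (n := 2) (N := 8)
    -- The edges {i, i+1} and {i, i+4} both have colour i mod 2. So i and i+2 see each other through
    -- i+1, and i and i+3 through i+4, where the colours are those of i and i+3.
    [((0, 1), .edge 0), ((1, 2), .edge 1), ((2, 3), .edge 0), ((3, 4), .edge 1),
      ((4, 5), .edge 0), ((5, 6), .edge 1), ((6, 7), .edge 0), ((7, 0), .edge 1),
      ((0, 4), .edge 0), ((1, 5), .edge 1), ((2, 6), .edge 0), ((3, 7), .edge 1)]
    (by decide +kernel) (by decide +kernel) (by decide +kernel) (by decide +kernel) m.zero_le hn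

/-- The Petersen graph with labels `s` on one pentagon, `t` on the other one, and `p` on the
spokes. -/
def petersenList {m n : ℕ} (s t : Fin 5 → AdjType m n) (p : AdjType m n) :
    List ((Fin 10 × Fin 10) × AdjType m n) :=
  [((0, 1), s 0), ((1, 2), s 1), ((2, 3), s 2), ((3, 4), s 3), ((4, 0), s 4),
    ((5, 7), t 0), ((7, 9), t 1), ((9, 6), t 2), ((6, 8), t 3), ((8, 5), t 4),
    ((0, 5), p), ((1, 6), p), ((2, 7), p), ((3, 8), p), ((4, 9), p)]

theorem exists_petersen_clique {m n : ℕ} (h : (m = 1 ∧ n = 1) ∨ 4 ≤ 2 * m + n) :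
    ∃ (V : Type) (_ : Finite V) (G : MNGraph m n V), MaxDegreeLE 3 V G.und ∧
      (∀ u v, u ≠ v → G.Sees u v) ∧ Nat.card V = 10 := by
  have h' : (1 ≤ m ∧ 1 ≤ n) ∨ 2 ≤ m ∨ 4 ≤ n := by omega
  rcases h' with ⟨hm, hn⟩ | hm | hn
  -- Non-adjacent vertices of the Petersen graph have a single common neighbour, so the three labels
  -- at each vertex must differ. A directed pentagon gives one arc in and one arc out at each
  -- vertex, and the spokes use another label.
  · exact exists_clique_of_list (m := 1) (n := 1) (N := 10)
      (petersenList (fun _ => .fwd 0) (fun _ => .fwd 0) (.edge 0))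
      (by decide +kernel) (by decide +kernel) (by decide +kernel) (by decide +kernel) hm hn
  · exact exists_clique_of_list (m := 2) (n := 0) (N := 10)
      (petersenList (fun _ => .fwd 0) (fun _ => .fwd 0) (.fwd 1))
      (by decide +kernel) (by decide +kernel) (by decide +kernel) (by decide +kernel) hm n.zero_le
  -- Edges alone need a proper colouring: three colours for each odd cycle and a fourth for the
  -- spokes.
  · exact exists_clique_of_list (m := 0) (n := 4) (N := 10)
      (petersenList (fun i => .edge (![0, 1, 0, 1, 2] i)) (fun i => .edge (![0, 1, 0, 1, 2] i))
        (.edge 3))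
      (by decide +kernel) (by decide +kernel) (by decide +kernel) (by decide +kernel) m.zero_le hn

end MNGraph

/-! ### Counting tools and the Moore bound -/

theorem Finset.exists_subset_pair {V : Type} [DecidableEq V] [Nonempty V] (s : Finset V)
    (h : s.card ≤ 2) : ∃ a b, ∀ v ∈ s, v = a ∨ v = b := by
  obtain ⟨c⟩ := ‹Nonempty V›
  interval_cases hs : s.card
  · exact ⟨c, c, by simp_all⟩
  · obtain ⟨a, rfl⟩ := Finset.card_eq_one.mp hs
    exact ⟨a, a, by simp⟩
  · obtain ⟨a, b, -, rfl⟩ := Finset.card_eq_two.mp hs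
    exact ⟨a, b, by simp⟩

/-- The equality case of a covering count: it turns tightness of a Moore-type bound into
distinctness of all the named vertices. -/
theorem List.nodup_and_subset_of_card {V : Type} [DecidableEq V] {R : Finset V} {l : List V}
    (hl : l.length ≤ R.card) (h : ∀ v ∈ R, v ∈ l) : l.Nodup ∧ ∀ v ∈ l, v ∈ R := by
  have hsub : R ⊆ l.toFinset := fun v hv => List.mem_toFinset.mpr (h v hv)
  have hc := Finset.card_le_card hsub
  have hl' := l.toFinset_card_le
  constructor
  · rw [← Multiset.coe_nodup, ← Multiset.toFinset_card_eq_card_iff_nodup]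
    change l.toFinset.card = l.length
    omega
  · intro v hv
    rw [Finset.eq_of_subset_of_card_le hsub (by omega)]
    exact List.mem_toFinset.mpr hv

namespace SimpleGraph

set_option linter.unusedSectionVars false

variable {V : Type} [Fintype V] [DecidableEq V] (U : SimpleGraph V) [DecidableRel U.Adj]

/-- Each neighbour of `u` accounts for itself and at most two further vertices. Keeping the degree
in the bound also shows that degree two allows only seven vertices. -/
theorem card_le_of_adj_or_common_neighbor (hdeg : ∀ v, U.degree v ≤ 3) (R : Finset V) (u : V)
    (h : ∀ v ∈ R, v ≠ u → U.Adj u v ∨ ∃ w, U.Adj u w ∧ U.Adj w v) :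
    R.card ≤ 1 + 3 * U.degree u := by
  have hsub : R ⊆ insert u (U.neighborFinset u ∪
      (U.neighborFinset u).biUnion fun w => (U.neighborFinset w).erase u) := by
    intro v hv
    by_cases hvu : v = u
    · simp [hvu]
    · rcases h v hv hvu with h | ⟨w, h1, h2⟩
      · simp [h]
      · simp only [Finset.mem_insert, Finset.mem_union, Finset.mem_biUnion, Finset.mem_erase,
          mem_neighborFinset]
        exact Or.inr (Or.inr ⟨w, h1, hvu, h2⟩)
  have h1 : ((U.neighborFinset u).biUnion fun w => (U.neighborFinset w).erase u).card ≤
      U.degree u * 2 := by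
    rw [← U.card_neighborFinset_eq_degree u]
    refine Finset.card_biUnion_le_card_mul _ _ _ fun w hw => ?_
    rw [Finset.card_erase_of_mem (by simpa [adj_comm] using hw), card_neighborFinset_eq_degree]
    have := hdeg w
    omega
  have h2 := Finset.card_le_card hsub
  have h3 := Finset.card_insert_le u (U.neighborFinset u ∪
      (U.neighborFinset u).biUnion fun w => (U.neighborFinset w).erase u)
  have h4 := Finset.card_union_le (U.neighborFinset u)
    ((U.neighborFinset u).biUnion fun w => (U.neighborFinset w).erase u)
  rw [card_neighborFinset_eq_degree] at h4
  omega

variable {U} in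
theorem exists_other_neighbors (hdeg : ∀ v, U.degree v ≤ 3) {w u : V} (h : U.Adj w u) :
    ∃ a b, ∀ v, U.Adj w v → v = u ∨ v = a ∨ v = b := by
  have : Nonempty V := ⟨u⟩
  obtain ⟨a, b, hab⟩ := Finset.exists_subset_pair ((U.neighborFinset w).erase u) (by
    rw [Finset.card_erase_of_mem (by simpa using h), card_neighborFinset_eq_degree]
    have := hdeg w
    omega)
  refine ⟨a, b, fun v hv => ?_⟩
  by_cases hvu : v = u
  · exact Or.inl hvu
  · exact Or.inr (hab v (by simp [hvu, hv]))

/-- A graph all of whose vertices in `R` have three neighbours in `R` has `R` of even order. -/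
theorem even_card_of_cubic (R : Finset V) (h3 : ∀ u ∈ R, U.degree u = 3)
    (hR : ∀ u ∈ R, ∀ v, U.Adj u v → v ∈ R) : Even R.card := by
  have hd : ∀ u : R, (U.induce (R : Set V)).degree u = 3 := by
    intro u
    rw [← h3 u u.2, ← card_neighborFinset_eq_degree, ← card_neighborFinset_eq_degree]
    refine Finset.card_bij (fun v _ => v.1) (by simp) (fun a _ b _ h => Subtype.ext h) ?_
    intro v hv
    rw [mem_neighborFinset] at hv
    exact ⟨⟨v, hR u u.2 v hv⟩, by simpa using hv, rfl⟩
  have hs := (U.induce (R : Set V)).sum_degrees_eq_twice_card_edges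
  have hs' : ∑ u : R, (U.induce (R : Set V)).degree u = R.card * 3 := by
    rw [Finset.sum_congr rfl fun u _ => hd u]
    simp
  have hs'' := hs'.symm.trans hs
  -- If E is the number of edges then 3|R| = 2E, so |R| = 2(E - |R|).
  exact ⟨(U.induce (R : Set V)).edgeFinset.card - R.card, by omega⟩

end SimpleGraph

/-! ### Three edge colours: no nine vertices see each other -/

set_option synthInstance.maxHeartbeats 400000 in
set_option synthInstance.maxSize 2000 in
set_option maxRecDepth 100000 in
/-- The Petersen graph without a vertex has no proper edge colouring with three colours; the
variables are the colours of the six-cycle `g, k, j, i, l, h` and of the other six edges. -/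
theorem no_three_edge_colouring_petersen_sub_vertex :
    ∀ g h : Fin 3, g ≠ h → ∀ k, k ≠ g → ∀ j, j ≠ k → ∀ i, i ≠ j → ∀ l, l ≠ i → l ≠ h →
      ∀ a, a ≠ g → a ≠ h → ∀ b, b ≠ i → b ≠ j → a ≠ b → ∀ c, c ≠ g → c ≠ k →
      ∀ d, d ≠ i → d ≠ l → c ≠ d → ∀ e, e ≠ h → e ≠ l → ∀ f, f ≠ j → f ≠ k → e = f := by
  -- Each constraint follows the last variable it involves, so the exhaustive check prunes early.
  -- The conclusion `e = f` denies properness at the last vertex.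
  decide +kernel

namespace SimpleGraph

/-- `u` and `v` are adjacent, or joined by a path of length two with edges of different colours. -/
def ColSees {V C : Type} (U : SimpleGraph V) (col : V → V → C) (u v : V) : Prop :=
  U.Adj u v ∨ ∃ w, U.Adj w u ∧ U.Adj w v ∧ col w u ≠ col w v

variable {V C : Type} [Fintype V] [DecidableEq V] {U : SimpleGraph V} [DecidableRel U.Adj]

theorem degree_eq_three_of_colSees (hdeg : ∀ v, U.degree v ≤ 3) {col : V → V → C} {R : Finset V}
    (hR : R.card = 9) (hs : ∀ u ∈ R, ∀ v ∈ R, u ≠ v → U.ColSees col u v) {u : V} (hu : u ∈ R) :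
    U.degree u = 3 := by
  have h := U.card_le_of_adj_or_common_neighbor hdeg R u fun v hv hvu => by
    rcases hs u hu v hv hvu.symm with h | ⟨w, h1, h2, -⟩
    · exact Or.inl h
    · exact Or.inr ⟨w, h1.symm, h2⟩
  have := hdeg u
  omega

/-- The ball of radius two around `u` has at most ten vertices, and one of them, `w`, is outside
`R`. The other nine places must therefore be filled by the nine vertices of `R` without repetition.
-/
theorem exists_neighborhood_of_colSees (hdeg : ∀ v, U.degree v ≤ 3) {col : V → V → C}
    {R : Finset V} (hR : R.card = 9) (hs : ∀ u ∈ R, ∀ v ∈ R, u ≠ v → U.ColSees col u v)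
    {u w : V} (hu : u ∈ R) (hw : w ∉ R) (huw : U.Adj u w) :
    ∃ b c x y b₁ b₂ c₁ c₂, [u, b, c, x, y, b₁, b₂, c₁, c₂].Nodup ∧
      (∀ v, v ∈ R ↔ v ∈ [u, b, c, x, y, b₁, b₂, c₁, c₂]) ∧
      (∀ v, U.Adj u v ↔ v = w ∨ v = b ∨ v = c) ∧ (∀ v, U.Adj w v ↔ v = u ∨ v = x ∨ v = y) ∧
      (∀ v, U.Adj b v ↔ v = u ∨ v = b₁ ∨ v = b₂) ∧
      (∀ v, U.Adj c v ↔ v = u ∨ v = c₁ ∨ v = c₂) := by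
  obtain ⟨b, c, hbc⟩ := exists_other_neighbors hdeg huw
  obtain ⟨x, y, hxy⟩ := exists_other_neighbors hdeg huw.symm
  have hd := degree_eq_three_of_colSees hdeg hR hs hu
  have hN : U.neighborFinset u = {w, b, c} := by
    refine Finset.eq_of_subset_of_card_le (fun v hv => ?_) ?_
    · simpa using hbc v (by simpa using hv)
    · rw [card_neighborFinset_eq_degree, hd]
      exact Finset.card_le_three
  have hN' : ∀ v, U.Adj u v ↔ v = w ∨ v = b ∨ v = c := by
    intro v
    rw [← mem_neighborFinset, hN]
    simp
  have hub : U.Adj u b := by simp [hN']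
  have huc : U.Adj u c := by simp [hN']
  obtain ⟨b₁, b₂, hb⟩ := exists_other_neighbors hdeg hub.symm
  obtain ⟨c₁, c₂, hc⟩ := exists_other_neighbors hdeg huc.symm
  -- The names may so far coincide or fail to be neighbours. The adjacency is recorded with each
  -- name so that distinctness later turns the inclusions of neighbourhoods into equalities.
  have cover : ∀ v ∈ R, v = u ∨ v = b ∨ v = c ∨ (v = x ∧ U.Adj w x) ∨ (v = y ∧ U.Adj w y) ∨
      (v = b₁ ∧ U.Adj b b₁) ∨ (v = b₂ ∧ U.Adj b b₂) ∨ (v = c₁ ∧ U.Adj c c₁) ∨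
      (v = c₂ ∧ U.Adj c c₂) := by
    intro v hv
    by_cases hvu : v = u
    · exact Or.inl hvu
    rcases hs u hu v hv (Ne.symm hvu) with h | ⟨z, h1, h2, -⟩
    · grind
    · rcases (hN' z).mp h1.symm with rfl | rfl | rfl <;> grind
  obtain ⟨hnd, hmem⟩ := List.nodup_and_subset_of_card (R := R)
    (l := [u, b, c, x, y, b₁, b₂, c₁, c₂]) (by simp [hR]) (fun v hv => by
      have := cover v hv
      simp only [List.mem_cons, List.not_mem_nil, or_false]
      tauto)
  have hmem' : ∀ v, v ∈ R ↔ v ∈ [u, b, c, x, y, b₁, b₂, c₁, c₂] := by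
    refine fun v => ⟨fun hv => ?_, hmem v⟩
    have := cover v hv
    simp only [List.mem_cons, List.not_mem_nil, or_false]
    tauto
  have hx := cover x (hmem x (by simp))
  have hy := cover y (hmem y (by simp))
  have hb1 := cover b₁ (hmem b₁ (by simp))
  have hb2 := cover b₂ (hmem b₂ (by simp))
  have hc1 := cover c₁ (hmem c₁ (by simp))
  have hc2 := cover c₂ (hmem c₂ (by simp))
  refine ⟨b, c, x, y, b₁, b₂, c₁, c₂, hnd, hmem', hN', ?_, ?_, ?_⟩
  · simp only [List.nodup_cons, List.mem_cons, List.not_mem_nil, or_false, not_or] at hnd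
    intro v
    refine ⟨hxy v, ?_⟩
    rintro (rfl | rfl | rfl)
    · exact huw.symm
    · grind
    · grind
  · simp only [List.nodup_cons, List.mem_cons, List.not_mem_nil, or_false, not_or] at hnd
    intro v
    refine ⟨hb v, ?_⟩
    rintro (rfl | rfl | rfl)
    · exact hub.symm
    · grind
    · grind
  · simp only [List.nodup_cons, List.mem_cons, List.not_mem_nil, or_false, not_or] at hnd
    intro v
    refine ⟨hc v, ?_⟩
    rintro (rfl | rfl | rfl)
    · exact huc.symm
    · grind
    · grind

end SimpleGraph

namespace SimpleGraph

variable {V C : Type} [Fintype V] [DecidableEq V] {U : SimpleGraph V} [DecidableRel U.Adj]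

/-- The ten vertices of the ball are distinct, so no triangle or four-cycle passes through `u`. It
applies to every neighbour of `w`, as these all lie in `R`. -/
theorem tree_of_colSees (hdeg : ∀ v, U.degree v ≤ 3) {col : V → V → C}
    {R : Finset V} (hR : R.card = 9) (hs : ∀ u ∈ R, ∀ v ∈ R, u ≠ v → U.ColSees col u v)
    {u w : V} (hu : u ∈ R) (hw : w ∉ R) (huw : U.Adj u w) :
    (∀ b c m, U.Adj u b → U.Adj u c → b ≠ c → U.Adj m b → U.Adj m c → m = u) ∧
      (∀ b c, U.Adj u b → U.Adj u c → ¬ U.Adj b c) ∧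
      (∃ b c, b ∈ R ∧ c ∈ R ∧ b ≠ c ∧ ∀ v, U.Adj u v ↔ v = w ∨ v = b ∨ v = c) := by
  obtain ⟨b, c, x, y, b₁, b₂, c₁, c₂, hnd, hmem, hNu, hNw, hNb, hNc⟩ :=
    exists_neighborhood_of_colSees hdeg hR hs hu hw huw
  have hwne : w ≠ b ∧ w ≠ c := by
    constructor <;> rintro rfl <;> exact hw (by simp [hmem])
  have hbR : b ∈ R := by simp [hmem]
  have hcR : c ∈ R := by simp [hmem]
  have hwm : ∀ v ∈ [u, b, c, x, y, b₁, b₂, c₁, c₂], v ≠ w := by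
    rintro v hv rfl
    exact hw ((hmem v).mpr hv)
  simp only [List.nodup_cons, List.mem_cons, List.not_mem_nil, or_false, not_or] at hnd
  simp only [List.forall_mem_cons] at hwm
  have hadj := fun a b => U.adj_comm a b
  clear hs hdeg hmem hR hw
  refine ⟨?_, ?_, b, c, hbR, hcR, by tauto, hNu⟩
  · have h1 : ∀ m, U.Adj m b → U.Adj m c → m = u := by
      intro m h1 h2
      rw [hadj, hNb] at h1
      rw [hadj, hNc] at h2
      grind
    have h2 : ∀ m, U.Adj m w → U.Adj m c → m = u := by
      intro m h1 h2
      rw [hadj, hNw] at h1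
      rw [hadj, hNc] at h2
      grind
    have h3 : ∀ m, U.Adj m w → U.Adj m b → m = u := by
      intro m h1 h2
      rw [hadj, hNw] at h1
      rw [hadj, hNb] at h2
      grind
    intro b' c' m hb hc hbc hmb hmc
    rw [hNu] at hb hc
    rcases hb with rfl | rfl | rfl <;> rcases hc with rfl | rfl | rfl <;> tauto
  · have h1 : ¬ U.Adj b c := by rw [hNb]; grind
    have h2 : ¬ U.Adj w b := by rw [hNw]; grind
    have h3 : ¬ U.Adj w c := by rw [hNw]; grind
    intro b' c' hb hc
    rw [hNu] at hb hc
    have h4 := fun a => U.loopless.irrefl a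
    rcases hb with rfl | rfl | rfl <;> rcases hc with rfl | rfl | rfl <;>
      first | exact h4 _ | assumption | (rw [hadj]; assumption)

end SimpleGraph

namespace SimpleGraph

variable {V : Type} [Fintype V] [DecidableEq V] {U : SimpleGraph V} [DecidableRel U.Adj]

/-- The adjacencies force the Petersen graph, with `w` the vertex outside `R`. Common neighbours in
it are unique, so seeing makes the colouring proper on the edges that avoid `w`. -/
theorem false_of_colSees_of_neighborhoods (hdeg : ∀ v, U.degree v ≤ 3) {col : V → V → Fin 3}
    (hcol : ∀ u v, col u v = col v u) {R : Finset V} (hR : R.card = 9)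
    (hs : ∀ u ∈ R, ∀ v ∈ R, u ≠ v → U.ColSees col u v) {w x x₁ x₂ y z p q r s : V} (hw : w ∉ R)
    (hnd : [x, x₁, x₂, y, z, p, q, r, s].Nodup)
    (hmem : ∀ v, v ∈ R ↔ v ∈ [x, x₁, x₂, y, z, p, q, r, s])
    (hNx : ∀ v, U.Adj x v ↔ v = w ∨ v = x₁ ∨ v = x₂)
    (hNw : ∀ v, U.Adj w v ↔ v = x ∨ v = y ∨ v = z)
    (hNx₁ : ∀ v, U.Adj x₁ v ↔ v = x ∨ v = p ∨ v = q)
    (hNx₂ : ∀ v, U.Adj x₂ v ↔ v = x ∨ v = r ∨ v = s)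
    (hNy : ∀ v, U.Adj y v ↔ v = w ∨ v = p ∨ v = r) : False := by
  have hyR : y ∈ R := by simp [hmem]
  have hzR : z ∈ R := by simp [hmem]
  have hyw : U.Adj y w := by simp [adj_comm _ y, hNw]
  have hzw : U.Adj z w := by simp [adj_comm _ z, hNw]
  have hadj := fun a b => U.adj_comm a b
  obtain ⟨hy4, hy3, -⟩ := tree_of_colSees hdeg hR hs hyR hw hyw
  obtain ⟨hz4, hz3, b, c, hbR, hcR, hbc, hNz'⟩ := tree_of_colSees hdeg hR hs hzR hw hzw
  simp only [List.nodup_cons, List.mem_cons, List.not_mem_nil, or_false, not_or] at hnd hmem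
  have hwne : w ≠ x ∧ w ≠ x₁ ∧ w ≠ x₂ ∧ w ≠ y ∧ w ≠ z ∧ w ≠ p ∧ w ≠ q ∧ w ≠ r ∧ w ≠ s := by
    simpa only [hmem, not_or] using hw
  have hyp : U.Adj y p := by simp [hNy]
  have hyr : U.Adj y r := by simp [hNy]
  have hx₁p : U.Adj x₁ p := by simp [hNx₁]
  have hx₁q : U.Adj x₁ q := by simp [hNx₁]
  have hx₂r : U.Adj x₂ r := by simp [hNx₂]
  have hx₂s : U.Adj x₂ s := by simp [hNx₂]
  have hNz : ∀ v, U.Adj z v ↔ v = w ∨ v = q ∨ v = s := by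
    have key : ∀ v ∈ R, U.Adj z v → v = q ∨ v = s := by
      intro v hv hzv
      have h1 := hz3 w v hzw hzv
      have h2 : ¬ U.Adj x₁ z := by rw [hNx₁]; clear * - hnd; grind
      have h2' : ¬ U.Adj x₂ z := by rw [hNx₂]; clear * - hnd; grind
      -- Otherwise `y`, `w`, `z`, `p` would form a four-cycle through `y`.
      have h3 : v ≠ p := by
        rintro rfl
        exact hnd.2.2.2.1.1 (hy4 w v z hyw hyp hwne.2.2.2.2.2.1 hzw hzv).symm
      have h4 : v ≠ r := by
        rintro rfl
        exact hnd.2.2.2.1.1 (hy4 w v z hyw hyr hwne.2.2.2.2.2.2.2.1 hzw hzv).symm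
      have h5 := (hadj z v).mp hzv
      rw [hNw, not_or, not_or] at h1
      rcases (hmem v).mp hv with h | h | h | h | h | h | h | h | h
      · exact absurd h h1.1
      · exact absurd (h ▸ h5) h2
      · exact absurd (h ▸ h5) h2'
      · exact absurd h h1.2.1
      · exact absurd h h1.2.2
      · exact absurd h h3
      · exact Or.inl h
      · exact absurd h h4
      · exact Or.inr h
    have hb := key b hbR (by simp [hNz'])
    have hc := key c hcR (by simp [hNz'])
    intro v
    rw [hNz']
    rcases hb with rfl | rfl <;> rcases hc with rfl | rfl
    · exact absurd rfl hbc
    · rfl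
    · rw [or_comm (a := v = b)]
    · exact absurd rfl hbc
  have hzq : U.Adj z q := by simp [hNz]
  have hzs : U.Adj z s := by simp [hNz]
  -- `x₁` must reach `s` through `x`, `p` or `q`; `x` is not adjacent to `s`, and `q` would close a
  -- triangle at `z`.
  have hNps : U.Adj p s := by
    have h1 : ¬ U.Adj x s := by rw [hNx]; clear * - hnd hwne; grind
    have h2 : ¬ U.Adj x₁ s := by rw [hNx₁]; clear * - hnd; grind
    rcases hs x₁ (by simp [hmem]) s (by simp [hmem]) (by clear * - hnd; grind) with h | ⟨m, h3, h4, -⟩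
    · exact absurd h h2
    · rcases (hNx₁ m).mp h3.symm with rfl | rfl | rfl
      · exact absurd h4 h1
      · exact h4
      · exact absurd h4 (hz3 _ _ hzq hzs)
  have hNqr : U.Adj q r := by
    have h1 : ¬ U.Adj x q := by rw [hNx]; clear * - hnd hwne; grind
    have h2 : ¬ U.Adj x₂ q := by rw [hNx₂]; clear * - hnd; grind
    rcases hs x₂ (by simp [hmem]) q (by simp [hmem]) (by clear * - hnd; grind) with h | ⟨m, h3, h4, -⟩
    · exact absurd h h2
    · rcases (hNx₂ m).mp h3.symm with rfl | rfl | rfl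
      · exact absurd h4 h1
      · exact h4.symm
      · exact absurd h4.symm (hz3 _ _ hzq hzs)
  have hthree : ∀ {v a b c : V}, U.Adj v a → U.Adj v b → U.Adj v c → a ≠ b → a ≠ c → b ≠ c →
      ∀ t, U.Adj v t ↔ t = a ∨ t = b ∨ t = c := by
    intro v a b c ha hb hc hab hac hbc t
    have : {a, b, c} = U.neighborFinset v := by
      refine Finset.eq_of_subset_of_card_le (fun t ht => ?_) ?_
      · simp only [Finset.mem_insert, Finset.mem_singleton] at ht
        rcases ht with rfl | rfl | rfl <;> simpa
      · rw [card_neighborFinset_eq_degree, Finset.card_eq_three.mpr ⟨a, b, c, hab, hac, hbc, rfl⟩]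
        exact hdeg v
    rw [← mem_neighborFinset, ← this]
    simp
  have hNp : ∀ v, U.Adj p v ↔ v = x₁ ∨ v = y ∨ v = s :=
    hthree hx₁p.symm hyp.symm hNps (by tauto) (by tauto) (by tauto)
  have hNq : ∀ v, U.Adj q v ↔ v = x₁ ∨ v = z ∨ v = r :=
    hthree hx₁q.symm hzq.symm hNqr (by tauto) (by tauto) (by tauto)
  have hNr : ∀ v, U.Adj r v ↔ v = x₂ ∨ v = y ∨ v = q :=
    hthree hx₂r.symm hyr.symm hNqr.symm (by tauto) (by tauto) (by tauto)
  have hNs : ∀ v, U.Adj s v ↔ v = x₂ ∨ v = z ∨ v = p :=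
    hthree hx₂s.symm hzs.symm hNps.symm (by tauto) (by tauto) (by tauto)
  -- `m` is the only common neighbour of the non-adjacent vertices `a` and `b`, so they can see each
  -- other only through it.
  have key : ∀ m {a a₁ a₂ b b₁ b₂}, (∀ v, U.Adj a v ↔ v = m ∨ v = a₁ ∨ v = a₂) →
      (∀ v, U.Adj b v ↔ v = m ∨ v = b₁ ∨ v = b₂) → a ∈ R → b ∈ R → [a, b, a₁, a₂, b₁, b₂].Nodup →
      m ≠ b → col m a ≠ col m b := by
    intro m a a₁ a₂ b b₁ b₂ hNa hNb ha hb hn hmb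
    simp only [List.nodup_cons, List.mem_cons, List.not_mem_nil, or_false, not_or] at hn
    rcases hs a ha b hb hn.1.1 with h | ⟨m', h1, h2, h3⟩
    · rw [hNa] at h
      clear * - h hn hmb
      grind
    · have : m' = m := by
        rw [hadj, hNa] at h1
        rw [hadj, hNb] at h2
        clear * - h1 h2 hn
        grind
      exact this ▸ h3
  have hxR : x ∈ R := by simp [hmem]
  have hx₁R : x₁ ∈ R := by simp [hmem]
  have hx₂R : x₂ ∈ R := by simp [hmem]
  have hpR : p ∈ R := by simp [hmem]
  have hqR : q ∈ R := by simp [hmem]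
  have hrR : r ∈ R := by simp [hmem]
  have hsR : s ∈ R := by simp [hmem]
  have gh : col x₁ p ≠ col x₁ q := by
    exact key x₁ hNp
      hNq hpR hqR
      (by simp only [List.nodup_cons, List.mem_cons, List.not_mem_nil, or_false, not_or]; clear * - hnd hwne; grind)
      (by clear * - hnd; grind)
  have kg : col p s ≠ col x₁ p := by
    rw [hcol x₁ p]
    exact key p (fun v => (hNs v).trans (by rw [← or_assoc, or_comm]))
      (fun v => (hNx₁ v).trans or_left_comm) hsR hx₁R
      (by simp only [List.nodup_cons, List.mem_cons, List.not_mem_nil, or_false, not_or]; clear * - hnd hwne; grind)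
      (by clear * - hnd; grind)
  have jk : col x₂ s ≠ col p s := by
    rw [hcol x₂ s, hcol p s]
    exact key s (fun v => (hNx₂ v).trans (by rw [← or_assoc, or_comm]))
      (fun v => (hNp v).trans (by rw [← or_assoc, or_comm])) hx₂R hpR
      (by simp only [List.nodup_cons, List.mem_cons, List.not_mem_nil, or_false, not_or]; clear * - hnd hwne; grind)
      (by clear * - hnd; grind)
  have ij : col x₂ r ≠ col x₂ s := by
    exact key x₂ hNr
      hNs hrR hsR
      (by simp only [List.nodup_cons, List.mem_cons, List.not_mem_nil, or_false, not_or]; clear * - hnd hwne; grind)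
      (by clear * - hnd; grind)
  have li : col q r ≠ col x₂ r := by
    rw [hcol q r, hcol x₂ r]
    exact key r (fun v => (hNq v).trans (by rw [← or_assoc, or_comm]))
      (fun v => (hNx₂ v).trans or_left_comm) hqR hx₂R
      (by simp only [List.nodup_cons, List.mem_cons, List.not_mem_nil, or_false, not_or]; clear * - hnd hwne; grind)
      (by clear * - hnd; grind)
  have lh : col q r ≠ col x₁ q := by
    rw [hcol x₁ q]
    exact key q (fun v => (hNr v).trans (by rw [← or_assoc, or_comm]))
      (fun v => (hNx₁ v).trans (by rw [← or_assoc, or_comm])) hrR hx₁R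
      (by simp only [List.nodup_cons, List.mem_cons, List.not_mem_nil, or_false, not_or]; clear * - hnd hwne; grind)
      (by clear * - hnd; grind)
  have ag : col x x₁ ≠ col x₁ p := by
    rw [hcol x x₁]
    exact key x₁ (fun v => (hNx v).trans or_left_comm)
      hNp hxR hpR
      (by simp only [List.nodup_cons, List.mem_cons, List.not_mem_nil, or_false, not_or]; clear * - hnd hwne; grind)
      (by clear * - hnd; grind)
  have ah : col x x₁ ≠ col x₁ q := by
    rw [hcol x x₁]
    exact key x₁ (fun v => (hNx v).trans or_left_comm)
      hNq hxR hqR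
      (by simp only [List.nodup_cons, List.mem_cons, List.not_mem_nil, or_false, not_or]; clear * - hnd hwne; grind)
      (by clear * - hnd; grind)
  have bi : col x x₂ ≠ col x₂ r := by
    rw [hcol x x₂]
    exact key x₂ (fun v => (hNx v).trans (by rw [← or_assoc, or_comm]))
      hNr hxR hrR
      (by simp only [List.nodup_cons, List.mem_cons, List.not_mem_nil, or_false, not_or]; clear * - hnd hwne; grind)
      (by clear * - hnd; grind)
  have bj : col x x₂ ≠ col x₂ s := by
    rw [hcol x x₂]
    exact key x₂ (fun v => (hNx v).trans (by rw [← or_assoc, or_comm]))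
      hNs hxR hsR
      (by simp only [List.nodup_cons, List.mem_cons, List.not_mem_nil, or_false, not_or]; clear * - hnd hwne; grind)
      (by clear * - hnd; grind)
  have ab : col x x₁ ≠ col x x₂ := by
    exact key x hNx₁
      hNx₂ hx₁R hx₂R
      (by simp only [List.nodup_cons, List.mem_cons, List.not_mem_nil, or_false, not_or]; clear * - hnd hwne; grind)
      (by clear * - hnd; grind)
  have cg : col y p ≠ col x₁ p := by
    rw [hcol y p, hcol x₁ p]
    exact key p (fun v => (hNy v).trans or_left_comm)
      (fun v => (hNx₁ v).trans or_left_comm) hyR hx₁R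
      (by simp only [List.nodup_cons, List.mem_cons, List.not_mem_nil, or_false, not_or]; clear * - hnd hwne; grind)
      (by clear * - hnd; grind)
  have ck : col y p ≠ col p s := by
    rw [hcol y p]
    exact key p (fun v => (hNy v).trans or_left_comm)
      (fun v => (hNs v).trans (by rw [← or_assoc, or_comm])) hyR hsR
      (by simp only [List.nodup_cons, List.mem_cons, List.not_mem_nil, or_false, not_or]; clear * - hnd hwne; grind)
      (by clear * - hnd; grind)
  have di : col y r ≠ col x₂ r := by
    rw [hcol y r, hcol x₂ r]
    exact key r (fun v => (hNy v).trans (by rw [← or_assoc, or_comm]))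
      (fun v => (hNx₂ v).trans or_left_comm) hyR hx₂R
      (by simp only [List.nodup_cons, List.mem_cons, List.not_mem_nil, or_false, not_or]; clear * - hnd hwne; grind)
      (by clear * - hnd; grind)
  have dl : col y r ≠ col q r := by
    rw [hcol y r, hcol q r]
    exact key r (fun v => (hNy v).trans (by rw [← or_assoc, or_comm]))
      (fun v => (hNq v).trans (by rw [← or_assoc, or_comm])) hyR hqR
      (by simp only [List.nodup_cons, List.mem_cons, List.not_mem_nil, or_false, not_or]; clear * - hnd hwne; grind)
      (by clear * - hnd; grind)
  have cd : col y p ≠ col y r := by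
    exact key y (fun v => (hNp v).trans or_left_comm)
      (fun v => (hNr v).trans or_left_comm) hpR hrR
      (by simp only [List.nodup_cons, List.mem_cons, List.not_mem_nil, or_false, not_or]; clear * - hnd hwne; grind)
      (by clear * - hnd; grind)
  have eh : col z q ≠ col x₁ q := by
    rw [hcol z q, hcol x₁ q]
    exact key q (fun v => (hNz v).trans or_left_comm)
      (fun v => (hNx₁ v).trans (by rw [← or_assoc, or_comm])) hzR hx₁R
      (by simp only [List.nodup_cons, List.mem_cons, List.not_mem_nil, or_false, not_or]; clear * - hnd hwne; grind)
      (by clear * - hnd; grind)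
  have el : col z q ≠ col q r := by
    rw [hcol z q]
    exact key q (fun v => (hNz v).trans or_left_comm)
      (fun v => (hNr v).trans (by rw [← or_assoc, or_comm])) hzR hrR
      (by simp only [List.nodup_cons, List.mem_cons, List.not_mem_nil, or_false, not_or]; clear * - hnd hwne; grind)
      (by clear * - hnd; grind)
  have fj : col z s ≠ col x₂ s := by
    rw [hcol z s, hcol x₂ s]
    exact key s (fun v => (hNz v).trans (by rw [← or_assoc, or_comm]))
      (fun v => (hNx₂ v).trans (by rw [← or_assoc, or_comm])) hzR hx₂R
      (by simp only [List.nodup_cons, List.mem_cons, List.not_mem_nil, or_false, not_or]; clear * - hnd hwne; grind)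
      (by clear * - hnd; grind)
  have fk : col z s ≠ col p s := by
    rw [hcol z s, hcol p s]
    exact key s (fun v => (hNz v).trans (by rw [← or_assoc, or_comm]))
      (fun v => (hNp v).trans (by rw [← or_assoc, or_comm])) hzR hpR
      (by simp only [List.nodup_cons, List.mem_cons, List.not_mem_nil, or_false, not_or]; clear * - hnd hwne; grind)
      (by clear * - hnd; grind)
  have ef : col z q ≠ col z s := by
    exact key z (fun v => (hNq v).trans or_left_comm)
      (fun v => (hNs v).trans or_left_comm) hqR hsR
      (by simp only [List.nodup_cons, List.mem_cons, List.not_mem_nil, or_false, not_or]; clear * - hnd hwne; grind)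
      (by clear * - hnd; grind)
  exact ef (no_three_edge_colouring_petersen_sub_vertex _ _ gh _ kg _ jk _ ij _ li lh _ ag ah _ bi bj ab _ cg ck _ di dl cd _ eh el _ fj fk)

theorem card_ne_nine_of_colSees (hdeg : ∀ v, U.degree v ≤ 3) {col : V → V → Fin 3}
    (hcol : ∀ u v, col u v = col v u) {R : Finset V}
    (hs : ∀ u ∈ R, ∀ v ∈ R, u ≠ v → U.ColSees col u v) : R.card ≠ 9 := by
  intro hR
  -- Otherwise `R` would span a cubic graph of odd order.
  obtain ⟨x, hx, w, hxw, hw⟩ : ∃ u ∈ R, ∃ v, U.Adj u v ∧ v ∉ R := by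
    by_contra! h
    have := U.even_card_of_cubic R (fun u hu => degree_eq_three_of_colSees hdeg hR hs hu) h
    rw [hR] at this
    revert this
    decide
  obtain ⟨x₁, x₂, y, z, p, q, r, s, hnd, hmem, hNx, hNw, hNx₁, hNx₂⟩ :=
    exists_neighborhood_of_colSees hdeg hR hs hx hw hxw
  have hadj := fun a b => U.adj_comm a b
  obtain ⟨y₁, y₂, hy₁, hy₂, hNy⟩ : ∃ y₁ y₂, (y₁ = p ∨ y₁ = q) ∧ (y₂ = r ∨ y₂ = s) ∧
      (∀ v, U.Adj y v ↔ v = w ∨ v = y₁ ∨ v = y₂) := by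
    have hyR : y ∈ R := by simp [hmem]
    have hyw : U.Adj y w := by simp [adj_comm _ y, hNw]
    obtain ⟨h4, h3, b, c, hbR, hcR, hbc, hNy⟩ := tree_of_colSees hdeg hR hs hyR hw hyw
    have hyb : U.Adj y b := by simp [hNy]
    have hyc : U.Adj y c := by simp [hNy]
    simp only [List.nodup_cons, List.mem_cons, List.not_mem_nil, or_false, not_or] at hnd hmem
    have key : ∀ v ∈ R, U.Adj y v → (v = p ∨ v = q) ∨ (v = r ∨ v = s) := by
      intro v hv hyv
      have h1 := h3 w v hyw hyv
      have hy := hnd.2.2.2.1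
      have h2 : ¬ U.Adj x₁ y := by
        rw [hNx₁]
        exact fun h => h.elim (fun h => hnd.1.2.2.1 h.symm) fun h => h.elim hy.2.1 hy.2.2.1
      have h2' : ¬ U.Adj x₂ y := by
        rw [hNx₂]
        exact fun h => h.elim (fun h => hnd.1.2.2.1 h.symm) fun h => h.elim hy.2.2.2.1 hy.2.2.2.2
      have h5 := (hadj y v).mp hyv
      rw [hNw, not_or, not_or] at h1
      rcases (hmem v).mp hv with h | h | h | h | h | h | h | h | h
      · exact absurd h h1.1
      · exact absurd (h ▸ h5) h2
      · exact absurd (h ▸ h5) h2'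
      · exact absurd h h1.2.1
      · exact absurd h h1.2.2
      all_goals simp [h]
    -- Two neighbours of `y` in one branch would give a four-cycle through `y`, so there is one in
    -- each branch.
    have h1 : ¬ ((b = p ∨ b = q) ∧ (c = p ∨ c = q)) := fun h =>
      hnd.2.1.2.1 (h4 b c x₁ hyb hyc hbc ((hNx₁ b).mpr (Or.inr h.1)) ((hNx₁ c).mpr (Or.inr h.2)))
    have h2 : ¬ ((b = r ∨ b = s) ∧ (c = r ∨ c = s)) := fun h =>
      hnd.2.2.1.1 (h4 b c x₂ hyb hyc hbc ((hNx₂ b).mpr (Or.inr h.1)) ((hNx₂ c).mpr (Or.inr h.2)))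
    rcases key b hbR hyb with hb | hb <;> rcases key c hcR hyc with hc | hc
    · exact absurd ⟨hb, hc⟩ h1
    · exact ⟨b, c, hb, hc, hNy⟩
    · exact ⟨c, b, hc, hb, fun v => by rw [hNy, or_comm (a := v = b)]⟩
    · exact absurd ⟨hb, hc⟩ h2
  -- `q'` and `s'` are the remaining leaves of the two branches; renaming within the branches
  -- reduces to the case where `y` is adjacent to the first leaf of each.
  obtain ⟨q', hq'⟩ : ∃ q', (y₁ = p ∧ q' = q) ∨ (y₁ = q ∧ q' = p) := by
    rcases hy₁ with h | h
    exacts [⟨q, Or.inl ⟨h, rfl⟩⟩, ⟨p, Or.inr ⟨h, rfl⟩⟩]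
  obtain ⟨s', hs'⟩ : ∃ s', (y₂ = r ∧ s' = s) ∨ (y₂ = s ∧ s' = r) := by
    rcases hy₂ with h | h
    exacts [⟨s, Or.inl ⟨h, rfl⟩⟩, ⟨r, Or.inr ⟨h, rfl⟩⟩]
  have hperm : [x, x₁, x₂, y, z, p, q, r, s].Perm [x, x₁, x₂, y, z, y₁, q', y₂, s'] := by
    refine .cons _ <| .cons _ <| .cons _ <| .cons _ <| .cons _ ?_
    rcases hq' with ⟨rfl, rfl⟩ | ⟨rfl, rfl⟩ <;> rcases hs' with ⟨rfl, rfl⟩ | ⟨rfl, rfl⟩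
    · exact .refl _
    · exact .cons _ <| .cons _ <| .swap _ _ _
    · exact .swap _ _ _
    · exact (List.Perm.swap _ _ _).trans <| .cons _ <| .cons _ <| .swap _ _ _
  refine false_of_colSees_of_neighborhoods hdeg hcol hR hs hw (hperm.nodup hnd)
    (fun v => (hmem v).trans hperm.mem_iff) hNx hNw (fun v => ?_) (fun v => ?_) hNy
  · rw [hNx₁]
    rcases hq' with ⟨rfl, rfl⟩ | ⟨rfl, rfl⟩
    exacts [Iff.rfl, or_congr_right or_comm]
  · rw [hNx₂]
    rcases hs' with ⟨rfl, rfl⟩ | ⟨rfl, rfl⟩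
    exacts [Iff.rfl, or_congr_right or_comm]

end SimpleGraph

/-! ### Orientations: counting the pairs that see each other -/

namespace SimpleGraph

set_option linter.unusedSectionVars false

variable {V : Type} [Fintype V] [DecidableEq V]

/-- `u` and `v` are adjacent, or joined by a directed path of length two of the orientation `D`. -/
def DirSees {V : Type} (U : SimpleGraph V) (D : V → V → Prop) (u v : V) : Prop :=
  U.Adj u v ∨ ∃ w, (D u w ∧ D w v) ∨ (D v w ∧ D w u)

/-- The ordered pairs of vertices of `R` joined by a directed path with middle vertex `w`, and,
for `w ∈ R`, the pairs `(u, w)` for the neighbours `u ∈ R` of `w`. -/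
def pairsAt (D : V → V → Prop) [DecidableRel D] (R : Finset V) (w : V) : Finset (V × V) :=
  R.filter (D · w) ×ˢ R.filter (D w) ∪ R.filter (D w) ×ˢ R.filter (D · w) ∪
    if w ∈ R then (R.filter (D · w) ∪ R.filter (D w)) ×ˢ {w} else ∅

theorem card_pairsAt_le (D : V → V → Prop) [DecidableRel D] (R : Finset V) (w : V) :
    (pairsAt D R w).card ≤ 2 * ((R.filter (D · w)).card * (R.filter (D w)).card) +
      if w ∈ R then (R.filter (D · w)).card + (R.filter (D w)).card else 0 := by
  unfold pairsAt
  refine (Finset.card_union_le _ _).trans (Nat.add_le_add ?_ ?_)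
  · refine (Finset.card_union_le _ _).trans ?_
    rw [Finset.card_product, Finset.card_product, mul_comm (R.filter (D w)).card]
    omega
  · split_ifs
    · rw [Finset.card_product, Finset.card_singleton, mul_one]
      exact Finset.card_union_le _ _
    · simp

variable {U : SimpleGraph V} [DecidableRel U.Adj] {D : V → V → Prop} [DecidableRel D]

theorem offDiag_subset_biUnion_pairsAt (hU : ∀ u v, U.Adj u v ↔ D u v ∨ D v u) {R : Finset V}
    (hs : ∀ u ∈ R, ∀ v ∈ R, u ≠ v → U.DirSees D u v) :
    R.offDiag ⊆ Finset.univ.biUnion (pairsAt D R) := by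
  rintro ⟨u, v⟩ huv
  rw [Finset.mem_offDiag] at huv
  obtain ⟨hu, hv, hne⟩ := huv
  simp only [Finset.mem_biUnion, Finset.mem_univ, true_and, pairsAt, Finset.mem_union,
    Finset.mem_product, Finset.mem_filter]
  rcases hs u hu v hv hne with h | ⟨w, h | h⟩
  · refine ⟨v, Or.inr ?_⟩
    rw [if_pos hv]
    rw [hU] at h
    simpa [hu] using h
  · exact ⟨w, Or.inl (Or.inl ⟨⟨hu, h.1⟩, hv, h.2⟩)⟩
  · exact ⟨w, Or.inl (Or.inr ⟨⟨hu, h.2⟩, hv, h.1⟩)⟩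

theorem card_in_add_card_out_le (hdeg : ∀ v, U.degree v ≤ 3) (hD : ∀ u v, D u v → ¬ D v u)
    (hU : ∀ u v, U.Adj u v ↔ D u v ∨ D v u) (R : Finset V) (w : V) :
    (R.filter (D · w)).card + (R.filter (D w)).card = (R.filter (U.Adj w)).card ∧
      (R.filter (U.Adj w)).card ≤ 3 := by
  constructor
  · rw [← Finset.card_union_of_disjoint]
    · congr 1
      ext v
      simp only [Finset.mem_union, Finset.mem_filter, hU]
      tauto
    · rw [Finset.disjoint_filter]
      exact fun v _ h1 h2 => hD _ _ h1 h2
  · refine (Finset.card_le_card fun v hv => ?_).trans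
      ((U.card_neighborFinset_eq_degree w).le.trans (hdeg w))
    rw [Finset.mem_filter] at hv
    simpa using hv.2

/-- Discharging, scaled by 3. A vertex outside `R` with i in-arcs from and o out-arcs to `R`
contributes at most 6io ≤ 4(i + o), so 4 is charged to each edge leaving `R`. A vertex of `R` with d
neighbours in `R` has at most 3 - d such edges and pays 6io + 3d + 4(3 - d). -/
theorem sum_card_pairsAt (hdeg : ∀ v, U.degree v ≤ 3) (hD : ∀ u v, D u v → ¬ D v u)
    (hU : ∀ u v, U.Adj u v ↔ D u v ∨ D v u) (R : Finset V) :
    3 * ∑ w, (pairsAt D R w).card ≤ ∑ u ∈ R, (6 * ((R.filter (D · u)).card * (R.filter (D u)).card)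
      + 12 - (R.filter (U.Adj u)).card) := by
  have key := card_in_add_card_out_le hdeg hD hU R
  have hout : ∑ w ∈ Rᶜ, (R.filter (U.Adj w)).card ≤ ∑ u ∈ R, (3 - (R.filter (U.Adj u)).card) := by
    have : ∑ w ∈ Rᶜ, (R.filter (U.Adj w)).card = ∑ u ∈ R, (Rᶜ.filter fun w => U.Adj w u).card :=
      Finset.sum_card_bipartiteAbove_eq_sum_card_bipartiteBelow _
    rw [this]
    refine Finset.sum_le_sum fun u _ => ?_
    have h1 : (Rᶜ.filter fun w => U.Adj w u).card + (R.filter (U.Adj u)).card ≤ 3 := by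
      rw [← Finset.card_union_of_disjoint]
      · refine (Finset.card_le_card fun v hv => ?_).trans
          ((U.card_neighborFinset_eq_degree u).le.trans (hdeg u))
        simp only [Finset.mem_union, Finset.mem_filter, adj_comm _ v] at hv
        rw [mem_neighborFinset]
        tauto
      · rw [Finset.disjoint_left]
        intro v h1 h2
        simp only [Finset.mem_filter, Finset.mem_compl] at h1 h2
        exact h1.1 h2.1
    omega
  have h1 : ∑ w ∈ Rᶜ, 3 * (pairsAt D R w).card ≤ ∑ w ∈ Rᶜ, 4 * (R.filter (U.Adj w)).card := by
    refine Finset.sum_le_sum fun w hw => ?_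
    have h := card_pairsAt_le D R w
    rw [if_neg (Finset.mem_compl.mp hw)] at h
    obtain ⟨h2, h3⟩ := key w
    generalize (R.filter (D · w)).card = i at *
    generalize (R.filter (D w)).card = o at *
    have : i ≤ 3 := by omega
    have : o ≤ 3 := by omega
    interval_cases i <;> interval_cases o <;> omega
  rw [Finset.mul_sum, ← Finset.sum_add_sum_compl R]
  rw [← Finset.mul_sum _ _ (4 : ℕ)] at h1
  have h2 := h1.trans (Nat.mul_le_mul_left 4 hout)
  rw [Finset.mul_sum] at h2
  refine (Nat.add_le_add_left h2 _).trans ?_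
  rw [← Finset.sum_add_distrib]
  refine Finset.sum_le_sum fun w hw => ?_
  have h := card_pairsAt_le D R w
  rw [if_pos hw] at h
  obtain ⟨h2, h3⟩ := key w
  omega

/-- The maximum is 6·2 + 12 - 3 = 21; with fewer than three neighbours in `R` the value is at most
16. -/
theorem in_mul_out_le (hdeg : ∀ v, U.degree v ≤ 3) (hD : ∀ u v, D u v → ¬ D v u)
    (hU : ∀ u v, U.Adj u v ↔ D u v ∨ D v u) (R : Finset V) (u : V) :
    6 * ((R.filter (D · u)).card * (R.filter (D u)).card) + 12 - (R.filter (U.Adj u)).card ≤ 21 ∧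
      (21 ≤ 6 * ((R.filter (D · u)).card * (R.filter (D u)).card) + 12 -
        (R.filter (U.Adj u)).card → (R.filter (U.Adj u)).card = 3) := by
  obtain ⟨h2, h3⟩ := card_in_add_card_out_le hdeg hD hU R u
  generalize (R.filter (D · u)).card = i at *
  generalize (R.filter (D u)).card = o at *
  have : i ≤ 3 := by omega
  have : o ≤ 3 := by omega
  interval_cases i <;> interval_cases o <;> omega

theorem sum_card_pairsAt_le
    (hdeg : ∀ v, U.degree v ≤ 3) (hD : ∀ u v, D u v → ¬ D v u)
    (hU : ∀ u v, U.Adj u v ↔ D u v ∨ D v u) {R : Finset V} (hR : R.card = 8) :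
    ∑ w, (pairsAt D R w).card ≤ 56 := by
  have h1 := sum_card_pairsAt hdeg hD hU R
  have h2 := Finset.sum_le_sum fun u (_ : u ∈ R) => (in_mul_out_le hdeg hD hU R u).1
  rw [Finset.sum_const, hR] at h2
  simp only [smul_eq_mul] at h2
  omega

/-- There are 8·7 = 56 ordered pairs to cover and 8·21 = 3·56, so every vertex of `R` must attain
the maximum 21. -/
theorem exists_neighbors_of_dirSees
    (hdeg : ∀ v, U.degree v ≤ 3) (hD : ∀ u v, D u v → ¬ D v u)
    (hU : ∀ u v, U.Adj u v ↔ D u v ∨ D v u) {R : Finset V} (hR : R.card = 8)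
    (hs : ∀ u ∈ R, ∀ v ∈ R, u ≠ v → U.DirSees D u v) {u : V} (hu : u ∈ R) :
    ∃ a b c, a ∈ R ∧ b ∈ R ∧ c ∈ R ∧ a ≠ b ∧ a ≠ c ∧ b ≠ c ∧
      ∀ v, U.Adj u v ↔ v = a ∨ v = b ∨ v = c := by
  have h0 : 56 ≤ ∑ w, (pairsAt D R w).card := by
    have := (Finset.card_le_card (offDiag_subset_biUnion_pairsAt hU hs)).trans
      Finset.card_biUnion_le
    rwa [Finset.offDiag_card, hR] at this
  have h1 := sum_card_pairsAt hdeg hD hU R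
  have h3 : (R.filter (U.Adj u)).card = 3 := by
    by_contra hne
    have h2 := Finset.sum_lt_sum (fun u (_ : u ∈ R) => (in_mul_out_le hdeg hD hU R u).1)
      ⟨u, hu, lt_of_not_ge fun h => hne ((in_mul_out_le hdeg hD hU R u).2 h)⟩
    rw [Finset.sum_const, hR] at h2
    simp only [smul_eq_mul] at h2
    omega
  have heq : R.filter (U.Adj u) = U.neighborFinset u := by
    refine Finset.eq_of_subset_of_card_le (fun v hv => ?_) ?_
    · rw [Finset.mem_filter] at hv
      simpa using hv.2
    · rw [h3]
      exact hdeg u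
  obtain ⟨a, b, c, hab, hac, hbc, habc⟩ := Finset.card_eq_three.mp h3
  have hmem : ∀ v, v ∈ ({a, b, c} : Finset V) → v ∈ R := by
    intro v hv
    rw [← habc] at hv
    exact (Finset.mem_filter.mp hv).1
  refine ⟨a, b, c, hmem a (by simp), hmem b (by simp), hmem c (by simp), hab, hac, hbc, ?_⟩
  intro v
  rw [← mem_neighborFinset, ← heq, habc]
  simp

/-- The count has no slack: the pair (`u`, `v`) would be covered both at `w` and at `v`, leaving
fewer than 56 distinct pairs. -/
theorem not_adj_of_directed_path
    (hdeg : ∀ v, U.degree v ≤ 3) (hD : ∀ u v, D u v → ¬ D v u)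
    (hU : ∀ u v, U.Adj u v ↔ D u v ∨ D v u) {R : Finset V} (hR : R.card = 8)
    (hs : ∀ u ∈ R, ∀ v ∈ R, u ≠ v → U.DirSees D u v) {u v w : V} (hu : u ∈ R) (hv : v ∈ R) (huw : D u w)
    (hwv : D w v) : ¬ U.Adj u v := by
  intro huv
  have hne : v ≠ w := by
    rintro rfl
    exact hD _ _ hwv hwv
  have hw : (u, v) ∈ pairsAt D R w := by
    simp [pairsAt, hu, hv, huw, hwv]
  have hv' : (u, v) ∈ pairsAt D R v := by
    have := (hU u v).mp huv
    simp [pairsAt, hu, hv, this]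
  have hsub : R.offDiag ⊆ (pairsAt D R w).erase (u, v) ∪
      (Finset.univ.erase w).biUnion (pairsAt D R) := by
    intro e he
    obtain ⟨t, -, ht⟩ := Finset.mem_biUnion.mp (offDiag_subset_biUnion_pairsAt hU hs he)
    by_cases htw : t = w
    · subst htw
      by_cases heq : e = (u, v)
      · exact Finset.mem_union_right _ (Finset.mem_biUnion.mpr ⟨v, by simpa using hne, heq ▸ hv'⟩)
      · exact Finset.mem_union_left _ (Finset.mem_erase.mpr ⟨heq, ht⟩)
    · exact Finset.mem_union_right _ (Finset.mem_biUnion.mpr ⟨t, by simpa using htw, ht⟩)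
  have h1 := (Finset.card_le_card hsub).trans (Finset.card_union_le _ _)
  have h2 := Finset.card_biUnion_le (s := Finset.univ.erase w) (t := pairsAt D R)
  have h3 := Finset.add_sum_erase Finset.univ (fun t => (pairsAt D R t).card) (Finset.mem_univ w)
  have h4 := sum_card_pairsAt_le hdeg hD hU hR
  have h5 := Finset.card_pos.mpr ⟨_, hw⟩
  rw [Finset.offDiag_card, hR, Finset.card_erase_of_mem hw] at h1
  omega

/-- Every orientation of a triangle contains a directed path of length two, whose ends are then
adjacent. -/
theorem not_adj_of_common_neighbor
    (hdeg : ∀ v, U.degree v ≤ 3) (hD : ∀ u v, D u v → ¬ D v u)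
    (hU : ∀ u v, U.Adj u v ↔ D u v ∨ D v u) {R : Finset V} (hR : R.card = 8)
    (hs : ∀ u ∈ R, ∀ v ∈ R, u ≠ v → U.DirSees D u v) {u v w : V} (hu : u ∈ R) (hv : v ∈ R) (hw : w ∈ R)
    (huw : U.Adj u w) (hwv : U.Adj w v) : ¬ U.Adj u v := by
  intro huv
  have key := @not_adj_of_directed_path V _ _ U _ D _ hdeg hD hU R hR hs
  rcases (hU u w).mp huw with h1 | h1 <;> rcases (hU w v).mp hwv with h2 | h2
  · exact key hu hv h1 h2 huv
  · rcases (hU u v).mp huv with h3 | h3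
    · exact key hu hw h3 h2 huw
    · exact key hv hw h3 h1 hwv.symm
  · rcases (hU u v).mp huv with h3 | h3
    · exact key hw hv h1 h3 hwv
    · exact key hw hu h2 h3 huw.symm
  · exact key hv hu h2 h1 huv.symm

end SimpleGraph

/-! ### Recognising the Wagner graph and excluding its orientations -/

namespace SimpleGraph

set_option linter.unusedSectionVars false

variable {V : Type} [DecidableEq V]

/-- `R` is the vertex set of a triangle-free cubic component of diameter at most two. -/
structure IsMooreLike (U : SimpleGraph V) (R : Finset V) : Prop where
  exists_neighbors : ∀ u ∈ R, ∃ a b c, a ∈ R ∧ b ∈ R ∧ c ∈ R ∧ a ≠ b ∧ a ≠ c ∧ b ≠ c ∧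
    ∀ v, U.Adj u v ↔ v = a ∨ v = b ∨ v = c
  not_adj : ∀ u ∈ R, ∀ w v, U.Adj u w → U.Adj w v → ¬ U.Adj u v
  adj_or : ∀ u ∈ R, ∀ v ∈ R, u ≠ v → U.Adj u v ∨ ∃ m, U.Adj u m ∧ U.Adj m v

variable {U : SimpleGraph V} {R : Finset V}

namespace IsMooreLike

theorem mem (h : U.IsMooreLike R) {u v : V} (hu : u ∈ R) (huv : U.Adj u v) : v ∈ R := by
  obtain ⟨a, b, c, ha, hb, hc, -, -, -, hN⟩ := h.exists_neighbors u hu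
  rcases (hN v).mp huv with rfl | rfl | rfl <;> assumption

theorem exists_other_two (h : U.IsMooreLike R) {u a : V} (hu : u ∈ R) (ha : U.Adj u a) :
    ∃ b c, a ≠ b ∧ a ≠ c ∧ b ≠ c ∧ ∀ v, U.Adj u v ↔ v = a ∨ v = b ∨ v = c := by
  obtain ⟨x, y, z, -, -, -, hxy, hxz, hyz, hN⟩ := h.exists_neighbors u hu
  rcases (hN a).mp ha with rfl | rfl | rfl
  · exact ⟨y, z, hxy, hxz, hyz, hN⟩
  · exact ⟨x, z, hxy.symm, hyz, hxz, fun v => (hN v).trans or_left_comm⟩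
  · exact ⟨x, y, hxz.symm, hyz.symm, hxy, fun v => (hN v).trans (by rw [← or_assoc, or_comm])⟩

theorem exists_third (h : U.IsMooreLike R) {u a b : V} (hu : u ∈ R) (ha : U.Adj u a)
    (hb : U.Adj u b) (hab : a ≠ b) :
    ∃ c, a ≠ c ∧ b ≠ c ∧ ∀ v, U.Adj u v ↔ v = a ∨ v = b ∨ v = c := by
  obtain ⟨x, y, hax, hay, hxy, hN⟩ := h.exists_other_two hu ha
  rcases (hN b).mp hb with rfl | rfl | rfl
  · exact absurd rfl hab
  · exact ⟨y, hay, hxy, hN⟩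
  · exact ⟨x, hax, hxy.symm, fun v => (hN v).trans (or_congr_right or_comm)⟩

/-- In a triangle-free cubic graph of diameter two on eight vertices, no two vertices have the same
neighbours. -/
theorem neighbors_ne (h : U.IsMooreLike R) (hR : R.card = 8) {p q x y z : V} (hp : p ∈ R)
    (hpq : p ≠ q) (hxy : x ≠ y) (hxz : x ≠ z) (hyz : y ≠ z)
    (hNp : ∀ v, U.Adj p v ↔ v = x ∨ v = y ∨ v = z)
    (hNq : ∀ v, U.Adj q v ↔ v = x ∨ v = y ∨ v = z) : False := by
  -- If `p` and `q` share all neighbours, the ball around `x` uses up all eight vertices, and the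
  -- third neighbour of `y` can only be a neighbour of `x'`. By symmetry the three third neighbours
  -- form a triangle.
  have key : ∀ x y z x' y', (∀ v, U.Adj p v ↔ v = x ∨ v = y ∨ v = z) →
      (∀ v, U.Adj q v ↔ v = x ∨ v = y ∨ v = z) → x ≠ y →
      (∀ v, U.Adj x v ↔ v = p ∨ v = q ∨ v = x') →
      (∀ v, U.Adj y v ↔ v = p ∨ v = q ∨ v = y') → p ≠ y' → q ≠ y' → U.Adj x' y' := by
    intro x y z x' y' hNp hNq hxy hNx hNy hpy' hqy'
    have hpx : U.Adj p x := by simp [hNp]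
    have hpy : U.Adj p y := by simp [hNp]
    have hpz : U.Adj p z := by simp [hNp]
    have hx : x ∈ R := h.mem hp hpx
    have hxx' : U.Adj x x' := by simp [hNx]
    have hyy' : U.Adj y y' := by simp [hNy]
    have hx' : x' ∈ R := h.mem hx hxx'
    have hy' : y' ∈ R := h.mem (h.mem hp hpy) hyy'
    obtain ⟨s, t, hxs, hxt, hst, hN'⟩ := h.exists_other_two hx' hxx'.symm
    have hcov : ∀ v ∈ R, v = x ∨ v = p ∨ v = q ∨ v = x' ∨ v = y ∨ v = z ∨ v = s ∨ v = t := by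
      intro v hv
      by_cases hxv : x = v
      · exact Or.inl hxv.symm
      rcases h.adj_or x hx v hv hxv with h1 | ⟨m, h1, h2⟩
      · rcases (hNx v).mp h1 with h1 | h1 | h1 <;> simp [h1]
      · rcases (hNx m).mp h1 with rfl | rfl | rfl
        · rcases (hNp v).mp h2 with h1 | h1 | h1 <;> simp [h1]
        · rcases (hNq v).mp h2 with h1 | h1 | h1 <;> simp [h1]
        · rcases (hN' v).mp h2 with h1 | h1 | h1 <;> simp [h1]
    obtain ⟨hnd, -⟩ := List.nodup_and_subset_of_card (R := R) (l := [x, p, q, x', y, z, s, t])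
      (by simp [hR]) (by simpa using hcov)
    simp only [List.nodup_cons, List.mem_cons, List.not_mem_nil, or_false, not_or] at hnd
    rw [hN']
    rcases hcov y' hy' with h1 | h1 | h1 | h1 | h1 | h1 | h1 | h1
    · exact absurd hpy (h.not_adj p hp x y hpx (h1 ▸ hyy').symm)
    · exact absurd h1.symm hpy'
    · exact absurd h1.symm hqy'
    · rcases (hN' y).mp (h1 ▸ hyy').symm with h2 | h2 | h2
      · exact absurd h2.symm hxy
      · exact absurd h2 hnd.2.2.2.2.1.2.1
      · exact absurd h2 hnd.2.2.2.2.1.2.2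
    · exact absurd h1.symm hyy'.ne
    · exact absurd hpz (h.not_adj p hp y z hpy (h1 ▸ hyy'))
    · exact Or.inr (Or.inl h1)
    · exact Or.inr (Or.inr h1)
  have third : ∀ x, U.Adj p x → U.Adj q x → ∃ x', p ≠ x' ∧ q ≠ x' ∧
      ∀ v, U.Adj x v ↔ v = p ∨ v = q ∨ v = x' :=
    fun x h1 h2 => h.exists_third (h.mem hp h1) h1.symm h2.symm hpq
  have hpx : U.Adj p x := by simp [hNp]
  obtain ⟨x', hpx', hqx', hNx⟩ := third x hpx (by simp [hNq])
  obtain ⟨y', hpy', hqy', hNy⟩ := third y (by simp [hNp]) (by simp [hNq])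
  obtain ⟨z', hpz', hqz', hNz⟩ := third z (by simp [hNp]) (by simp [hNq])
  have h1 := key x y z x' y' hNp hNq hxy hNx hNy hpy' hqy'
  have h2 := key y z x y' z' (fun v => (hNp v).trans (by tauto)) (fun v => (hNq v).trans (by tauto))
    hyz hNy hNz hpz' hqz'
  have h3 := key x z y x' z' (fun v => (hNp v).trans (by tauto)) (fun v => (hNq v).trans (by tauto))
    hxz hNx hNz hpz' hqz'
  exact h.not_adj x' (h.mem (h.mem hp hpx) (by simp [hNx])) y' z' h1 h2 h3

/-- A triangle-free cubic graph of diameter two on eight vertices contains a four-cycle. -/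
theorem exists_four_cycle (h : U.IsMooreLike R) (hR : R.card = 8) :
    ∃ o m a b, o ∈ R ∧ o ≠ m ∧ a ≠ b ∧ U.Adj o a ∧ U.Adj o b ∧ U.Adj m a ∧ U.Adj m b := by
  by_contra! hno
  obtain ⟨o, ho⟩ : R.Nonempty := by
    rw [← Finset.card_pos]
    omega
  obtain ⟨a, b, c, ha, hb, hc, hab, hac, hbc, hN⟩ := h.exists_neighbors o ho
  have hoa : U.Adj o a := by simp [hN]
  have hob : U.Adj o b := by simp [hN]
  have hoc : U.Adj o c := by simp [hN]
  obtain ⟨a₁, a₂, h1, h2, h3, hNa⟩ := h.exists_other_two ha hoa.symm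
  obtain ⟨b₁, b₂, h4, h5, h6, hNb⟩ := h.exists_other_two hb hob.symm
  obtain ⟨c₁, c₂, h7, h8, h9, hNc⟩ := h.exists_other_two hc hoc.symm
  have haa₁ : U.Adj a a₁ := by simp [hNa]
  have haa₂ : U.Adj a a₂ := by simp [hNa]
  have hbb₁ : U.Adj b b₁ := by simp [hNb]
  have hbb₂ : U.Adj b b₂ := by simp [hNb]
  have hcc₁ : U.Adj c c₁ := by simp [hNc]
  have hcc₂ : U.Adj c c₂ := by simp [hNc]
  have key : ∀ {x y s t}, x ≠ y → U.Adj o x → U.Adj o y → U.Adj x s → U.Adj y t → o ≠ s →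
      s ≠ t := by
    rintro x y s t hxy hx hy hs ht hos rfl
    exact hno o s x y ho hos hxy hx hy hs.symm ht.symm
  have tri : ∀ {x y s}, U.Adj o x → U.Adj o y → U.Adj x s → y ≠ s := by
    rintro x y s hx hy hs rfl
    exact h.not_adj o ho x y hx hs hy
  -- Without a four-cycle the ball around `o` is a tree on ten vertices, too many for `R`.
  have hnd : [o, a, b, c, a₁, a₂, b₁, b₂, c₁, c₂].Nodup := by
    simp only [List.nodup_cons, List.mem_cons, List.not_mem_nil, or_false, not_or, not_false_eq_true,
      List.nodup_nil, and_true]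
    exact ⟨⟨hoa.ne, hob.ne, hoc.ne, h1, h2, h4, h5, h7, h8⟩,
      ⟨hab, hac, haa₁.ne, haa₂.ne, tri hob hoa hbb₁, tri hob hoa hbb₂, tri hoc hoa hcc₁,
        tri hoc hoa hcc₂⟩,
      ⟨hbc, tri hoa hob haa₁, tri hoa hob haa₂, hbb₁.ne, hbb₂.ne, tri hoc hob hcc₁,
        tri hoc hob hcc₂⟩,
      ⟨tri hoa hoc haa₁, tri hoa hoc haa₂, tri hob hoc hbb₁, tri hob hoc hbb₂, hcc₁.ne, hcc₂.ne⟩,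
      ⟨h3, key hab hoa hob haa₁ hbb₁ h1, key hab hoa hob haa₁ hbb₂ h1, key hac hoa hoc haa₁ hcc₁ h1,
        key hac hoa hoc haa₁ hcc₂ h1⟩,
      ⟨key hab hoa hob haa₂ hbb₁ h2, key hab hoa hob haa₂ hbb₂ h2, key hac hoa hoc haa₂ hcc₁ h2,
        key hac hoa hoc haa₂ hcc₂ h2⟩,
      ⟨h6, key hbc hob hoc hbb₁ hcc₁ h4, key hbc hob hoc hbb₁ hcc₂ h4⟩,
      ⟨key hbc hob hoc hbb₂ hcc₁ h5, key hbc hob hoc hbb₂ hcc₂ h5⟩, h9⟩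
  have hsub : [o, a, b, c, a₁, a₂, b₁, b₂, c₁, c₂].toFinset ⊆ R := by
    intro v hv
    simp only [List.mem_toFinset, List.mem_cons, List.not_mem_nil, or_false] at hv
    rcases hv with rfl | rfl | rfl | rfl | rfl | rfl | rfl | rfl | rfl | rfl
    exacts [ho, ha, hb, hc, h.mem ha haa₁, h.mem ha haa₂, h.mem hb hbb₁, h.mem hb hbb₂,
      h.mem hc hcc₁, h.mem hc hcc₂]
  have := Finset.card_le_card hsub
  rw [List.toFinset_card_of_nodup hnd, hR] at this
  simp at this

theorem neighbors_eq (h : U.IsMooreLike R) {u a b c : V} (hu : u ∈ R) (ha : U.Adj u a)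
    (hb : U.Adj u b) (hc : U.Adj u c) (hab : a ≠ b) (hac : a ≠ c) (hbc : b ≠ c) (v : V) :
    U.Adj u v ↔ v = a ∨ v = b ∨ v = c := by
  obtain ⟨c', -, -, hN⟩ := h.exists_third hu ha hb hab
  rcases (hN c).mp hc with rfl | rfl | rfl
  · exact absurd rfl hac
  · exact absurd rfl hbc
  · exact hN v

/-- The Wagner graph is the only triangle-free cubic graph of diameter two on eight vertices. -/
theorem exists_wagner (h : U.IsMooreLike R) (hR : R.card = 8) :
    ∃ v₀ v₁ v₂ v₃ v₄ v₅ v₆ v₇, [v₀, v₁, v₂, v₃, v₄, v₅, v₆, v₇].Nodup ∧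
      (∀ v, v ∈ R ↔ v ∈ [v₀, v₁, v₂, v₃, v₄, v₅, v₆, v₇]) ∧
      (∀ v, U.Adj v₀ v ↔ v = v₇ ∨ v = v₁ ∨ v = v₄) ∧ (∀ v, U.Adj v₁ v ↔ v = v₀ ∨ v = v₂ ∨ v = v₅) ∧
      (∀ v, U.Adj v₂ v ↔ v = v₁ ∨ v = v₃ ∨ v = v₆) ∧ (∀ v, U.Adj v₃ v ↔ v = v₂ ∨ v = v₄ ∨ v = v₇) ∧
      (∀ v, U.Adj v₄ v ↔ v = v₃ ∨ v = v₅ ∨ v = v₀) ∧ (∀ v, U.Adj v₅ v ↔ v = v₄ ∨ v = v₆ ∨ v = v₁) ∧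
      (∀ v, U.Adj v₆ v ↔ v = v₅ ∨ v = v₇ ∨ v = v₂) ∧
      (∀ v, U.Adj v₇ v ↔ v = v₆ ∨ v = v₀ ∨ v = v₃) := by
  obtain ⟨o, m, a, b, ho, hom, hab, hoa, hob, hma, hmb⟩ := h.exists_four_cycle hR
  have ha := h.mem ho hoa
  have hb := h.mem ho hob
  have hm := h.mem ha hma.symm
  obtain ⟨c, hac, hbc, hNo⟩ := h.exists_third ho hoa hob hab
  obtain ⟨d, had, hbd, hNm⟩ := h.exists_third hm hma hmb hab
  obtain ⟨e, hoe, hme, hNa⟩ := h.exists_third ha hoa.symm hma.symm hom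
  obtain ⟨f, hof, hmf, hNb⟩ := h.exists_third hb hob.symm hmb.symm hom
  have hoc : U.Adj o c := by simp [hNo]
  have hmd : U.Adj m d := by simp [hNm]
  have hae : U.Adj a e := by simp [hNa]
  have hbf : U.Adj b f := by simp [hNb]
  have hc := h.mem ho hoc
  have hd := h.mem hm hmd
  have he := h.mem ha hae
  have hf := h.mem hb hbf
  have hcd : c ≠ d := by
    rintro rfl
    exact h.neighbors_ne hR ho hom hab hac hbc hNo hNm
  have hef : e ≠ f := by
    rintro rfl
    exact h.neighbors_ne hR ha hab hom hoe hme hNa hNb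
  have tri : ∀ {x y z}, x ∈ R → U.Adj x y → U.Adj x z → ¬ U.Adj y z :=
    fun hx hy hz hyz => h.not_adj _ hx _ _ hy hyz hz
  have ne : ∀ {x y z}, x ∈ R → U.Adj x y → U.Adj y z → ∀ {w}, U.Adj x w → w ≠ z := by
    rintro x y z hx hxy hyz w hw rfl
    exact tri hx hxy hw hyz
  have hcm : c ≠ m := ne ho hoa hma.symm hoc
  have hdo : d ≠ o := ne hm hma hoa.symm hmd
  have heb : e ≠ b := ne ha hoa.symm hob hae
  have hfa : f ≠ a := ne hb hob.symm hoa hbf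
  have hce : c ≠ e := ne ho hoa hae hoc
  have hcf : c ≠ f := ne ho hob hbf hoc
  have hde : d ≠ e := ne hm hma hae hmd
  have hdf : d ≠ f := ne hm hmb hbf hmd
  have hnd : [o, a, e, f, b, m, d, c].Nodup := by
    simp only [List.nodup_cons, List.mem_cons, List.not_mem_nil, or_false, not_or, not_false_eq_true,
      List.nodup_nil, and_true]
    exact ⟨⟨hoa.ne, hoe, hof, hob.ne, hom, hdo.symm, hoc.ne⟩, ⟨hae.ne, hfa.symm, hab, hma.symm.ne,
      had, hac⟩, ⟨hef, heb, hme.symm, hde.symm, hce.symm⟩, ⟨hbf.symm.ne, hmf.symm, hdf.symm,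
      hcf.symm⟩, ⟨hmb.symm.ne, hbd, hbc⟩, ⟨hmd.ne, hcm.symm⟩, hcd.symm⟩
  have hmem : ∀ v, v ∈ R ↔ v ∈ [o, a, e, f, b, m, d, c] := by
    have hsub : [o, a, e, f, b, m, d, c].toFinset ⊆ R := by
      intro v hv
      simp only [List.mem_toFinset, List.mem_cons, List.not_mem_nil, or_false] at hv
      rcases hv with rfl | rfl | rfl | rfl | rfl | rfl | rfl | rfl <;> assumption
    have heq := Finset.eq_of_subset_of_card_le hsub
      (by rw [List.toFinset_card_of_nodup hnd, hR]; simp)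
    intro v
    rw [← heq, List.mem_toFinset]
  -- `o` and `d` are not adjacent, and a common neighbour `a` or `b` would give a triangle with `m`;
  -- only `c` remains.
  have hadcd : U.Adj c d := by
    rcases h.adj_or o ho d hd hdo.symm with h1 | ⟨x, h1, h2⟩
    · rcases (hNo d).mp h1 with h1 | h1 | h1
      exacts [absurd h1.symm had, absurd h1.symm hbd, absurd h1.symm hcd]
    · rcases (hNo x).mp h1 with rfl | rfl | rfl
      · exact absurd h2 (tri hm hma hmd)
      · exact absurd h2 (tri hm hmb hmd)
      · exact h2
  have hadef : U.Adj e f := by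
    rcases h.adj_or a ha f hf hfa.symm with h1 | ⟨x, h1, h2⟩
    · rcases (hNa f).mp h1 with h1 | h1 | h1
      exacts [absurd h1.symm hof, absurd h1.symm hmf, absurd h1.symm hef]
    · rcases (hNa x).mp h1 with rfl | rfl | rfl
      · exact absurd h2 (tri hb hob.symm hbf)
      · exact absurd h2 (tri hb hmb.symm hbf)
      · exact h2
  have mem_of_adj : ∀ {x y}, x ∈ R → U.Adj x y → y = o ∨ y = a ∨ y = e ∨ y = f ∨ y = b ∨ y = m ∨
      y = d ∨ y = c := fun hx hxy => by simpa using (hmem _).mp (h.mem hx hxy)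
  obtain ⟨s, hos, hds, hNc⟩ := h.exists_third hc hoc.symm hadcd hdo.symm
  have hcs : U.Adj c s := by simp [hNc]
  obtain ⟨t, hmt, hct, hNd⟩ := h.exists_third hd hmd.symm hadcd.symm hcm.symm
  have hdt : U.Adj d t := by simp [hNd]
  have hs : s = e ∨ s = f := by
    rcases mem_of_adj hc hcs with rfl | rfl | h1 | h1 | rfl | rfl | rfl | rfl
    · exact absurd rfl hos
    · exact absurd hcs (tri ho hoc hoa)
    · exact Or.inl h1
    · exact Or.inr h1
    · exact absurd hcs (tri ho hoc hob)
    · exact absurd hcs.symm (by rw [hNm]; simp [hac.symm, hbc.symm, hcd])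
    · exact absurd rfl hds
    · exact absurd hcs (U.loopless.irrefl _)
  have ht : t = e ∨ t = f := by
    rcases mem_of_adj hd hdt with rfl | rfl | h1 | h1 | rfl | rfl | rfl | rfl
    · exact absurd hdt.symm (by rw [hNo]; simp [had.symm, hbd.symm, hcd.symm])
    · exact absurd hdt (tri hm hmd hma)
    · exact Or.inl h1
    · exact Or.inr h1
    · exact absurd hdt (tri hm hmd hmb)
    · exact absurd rfl hmt
    · exact absurd hdt (U.loopless.irrefl _)
    · exact absurd rfl hct
  have hst : s ≠ t := by
    rintro rfl
    exact tri hc hadcd hcs hdt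
  -- `c` and `d` are matched with `e` and `f`. The two matchings differ by exchanging `a` with `b`
  -- and `e` with `f`, and both give the Wagner graph.
  rcases hs with rfl | rfl <;> rcases ht with rfl | rfl
  · exact absurd rfl hst
  · have hperm : [o, a, s, t, b, m, d, c].Perm [o, b, t, s, a, m, d, c] :=
      .cons _ ((List.reverse_perm [b, t, s, a]).append_right [m, d, c])
    exact ⟨o, b, t, s, a, m, d, c, hperm.nodup hnd, fun v => (hmem v).trans hperm.mem_iff,
      h.neighbors_eq ho hoc hob hoa hbc.symm hac.symm hab.symm,
      h.neighbors_eq hb hob.symm hbf hmb.symm hof hom hmf.symm,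
      h.neighbors_eq hf hbf.symm hadef.symm hdt.symm heb.symm hbd hde.symm,
      h.neighbors_eq he hadef hae.symm hcs.symm hfa hcf.symm hac,
      h.neighbors_eq ha hae hma.symm hoa.symm hme.symm hoe.symm hom.symm,
      h.neighbors_eq hm hma hmd hmb had hab hbd.symm,
      h.neighbors_eq hd hmd.symm hadcd.symm hdt hcm.symm hmf hcf,
      h.neighbors_eq hc hadcd hoc.symm hcs hdo hde hoe⟩
  · exact ⟨o, a, t, s, b, m, d, c, hnd, hmem,
      h.neighbors_eq ho hoc hoa hob hac.symm hbc.symm hab,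
      h.neighbors_eq ha hoa.symm hae hma.symm hoe hom hme.symm,
      h.neighbors_eq he hae.symm hadef hdt.symm hfa.symm had hdf.symm,
      h.neighbors_eq hf hadef.symm hbf.symm hcs.symm heb hce.symm hbc,
      h.neighbors_eq hb hbf hmb.symm hob.symm hmf.symm hof.symm hom.symm,
      h.neighbors_eq hm hmb hmd hma hbd hab.symm had.symm,
      h.neighbors_eq hd hmd.symm hadcd.symm hdt hcm.symm hme hce,
      h.neighbors_eq hc hadcd hoc.symm hcs hdo hdf hof⟩
  · exact absurd rfl hst

end IsMooreLike

/-- On the Wagner graph, vertices two apart on the rim have one common neighbour, so the rim is a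
directed cycle, say upwards. Vertices i and i+3 then need the chord i+4 → i or the chord i+3 → i+7.
Let a, b, c, d say that the chords 4 → 0, 5 → 1, 6 → 2, 7 → 3 are present; the eight conditions
become a ≠ b, b ≠ c, c ≠ d and a = d, which is absurd. -/
theorem card_ne_eight_of_dirSees [Fintype V] [DecidableRel U.Adj] {D : V → V → Prop}
    [DecidableRel D] (hdeg : ∀ v, U.degree v ≤ 3) (hD : ∀ u v, D u v → ¬ D v u)
    (hU : ∀ u v, U.Adj u v ↔ D u v ∨ D v u) (hs : ∀ u ∈ R, ∀ v ∈ R, u ≠ v → U.DirSees D u v) :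
    R.card ≠ 8 := by
  intro hR
  have hmoore : U.IsMooreLike R := by
    have hN := fun u (hu : u ∈ R) => exists_neighbors_of_dirSees hdeg hD hU hR hs hu
    have hmem : ∀ u ∈ R, ∀ v, U.Adj u v → v ∈ R := by
      intro u hu v huv
      obtain ⟨a, b, c, ha, hb, hc, -, -, -, h⟩ := hN u hu
      rcases (h v).mp huv with rfl | rfl | rfl <;> assumption
    refine ⟨hN, fun u hu w v huw hwv => ?_, fun u hu v hv huv => ?_⟩
    · have hw := hmem u hu w huw
      exact not_adj_of_common_neighbor hdeg hD hU hR hs hu (hmem w hw v hwv) hw huw hwv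
    · rcases hs u hu v hv huv with h | ⟨m, h | h⟩
      · exact Or.inl h
      · exact Or.inr ⟨m, (hU _ _).mpr (Or.inl h.1), (hU _ _).mpr (Or.inl h.2)⟩
      · exact Or.inr ⟨m, (hU _ _).mpr (Or.inr h.2), (hU _ _).mpr (Or.inr h.1)⟩
  obtain ⟨v₀, v₁, v₂, v₃, v₄, v₅, v₆, v₇, hnd, hmem, h₀, h₁, h₂, h₃, h₄, h₅, h₆, h₇⟩ :=
    hmoore.exists_wagner hR
  have hR' : v₀ ∈ R ∧ v₁ ∈ R ∧ v₂ ∈ R ∧ v₃ ∈ R ∧ v₄ ∈ R ∧ v₅ ∈ R ∧ v₆ ∈ R ∧ v₇ ∈ R := by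
    simp [hmem]
  obtain ⟨r₀, r₁, r₂, r₃, r₄, r₅, r₆, r₇⟩ := hR'
  simp only [List.nodup_cons, List.mem_cons, List.not_mem_nil, or_false, not_or] at hnd
  have path : ∀ a m n k b, (∀ v, U.Adj a v ↔ v = m ∨ v = n ∨ v = k) → a ∈ R → b ∈ R → a ≠ b →
      ¬ U.Adj a b → (D a m ∧ D m b ∨ D b m ∧ D m a) ∨ (D a n ∧ D n b ∨ D b n ∧ D n a) ∨
        (D a k ∧ D k b ∨ D b k ∧ D k a) := by
    intro a m n k b hNa ha hb hab hnab
    rcases hs a ha b hb hab with h | ⟨w, h⟩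
    · exact absurd h hnab
    · have hw : U.Adj a w := (hU a w).mpr (h.imp And.left And.right)
      rcases (hNa w).mp hw with rfl | rfl | rfl
      · exact Or.inl h
      · exact Or.inr (Or.inl h)
      · exact Or.inr (Or.inr h)
  have n02 : ¬ U.Adj v₀ v₂ := by rw [h₀]; clear * - hnd; grind
  have n03 : ¬ U.Adj v₀ v₃ := by rw [h₀]; clear * - hnd; grind
  have n05 : ¬ U.Adj v₀ v₅ := by rw [h₀]; clear * - hnd; grind
  have n06 : ¬ U.Adj v₀ v₆ := by rw [h₀]; clear * - hnd; grind
  have n13 : ¬ U.Adj v₁ v₃ := by rw [h₁]; clear * - hnd; grind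
  have n14 : ¬ U.Adj v₁ v₄ := by rw [h₁]; clear * - hnd; grind
  have n16 : ¬ U.Adj v₁ v₆ := by rw [h₁]; clear * - hnd; grind
  have n17 : ¬ U.Adj v₁ v₇ := by rw [h₁]; clear * - hnd; grind
  have n24 : ¬ U.Adj v₂ v₄ := by rw [h₂]; clear * - hnd; grind
  have n25 : ¬ U.Adj v₂ v₅ := by rw [h₂]; clear * - hnd; grind
  have n27 : ¬ U.Adj v₂ v₇ := by rw [h₂]; clear * - hnd; grind
  have n35 : ¬ U.Adj v₃ v₅ := by rw [h₃]; clear * - hnd; grind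
  have n36 : ¬ U.Adj v₃ v₆ := by rw [h₃]; clear * - hnd; grind
  have n46 : ¬ U.Adj v₄ v₆ := by rw [h₄]; clear * - hnd; grind
  have n47 : ¬ U.Adj v₄ v₇ := by rw [h₄]; clear * - hnd; grind
  have n57 : ¬ U.Adj v₅ v₇ := by rw [h₅]; clear * - hnd; grind
  have p02 := path _ _ _ _ _ h₀ r₀ r₂ (by clear * - hnd; grind) n02
  have p03 := path _ _ _ _ _ h₀ r₀ r₃ (by clear * - hnd; grind) n03
  have p05 := path _ _ _ _ _ h₀ r₀ r₅ (by clear * - hnd; grind) n05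
  have p06 := path _ _ _ _ _ h₀ r₀ r₆ (by clear * - hnd; grind) n06
  have p13 := path _ _ _ _ _ h₁ r₁ r₃ (by clear * - hnd; grind) n13
  have p14 := path _ _ _ _ _ h₁ r₁ r₄ (by clear * - hnd; grind) n14
  have p16 := path _ _ _ _ _ h₁ r₁ r₆ (by clear * - hnd; grind) n16
  have p17 := path _ _ _ _ _ h₁ r₁ r₇ (by clear * - hnd; grind) n17
  have p24 := path _ _ _ _ _ h₂ r₂ r₄ (by clear * - hnd; grind) n24
  have p25 := path _ _ _ _ _ h₂ r₂ r₅ (by clear * - hnd; grind) n25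
  have p27 := path _ _ _ _ _ h₂ r₂ r₇ (by clear * - hnd; grind) n27
  have p35 := path _ _ _ _ _ h₃ r₃ r₅ (by clear * - hnd; grind) n35
  have p36 := path _ _ _ _ _ h₃ r₃ r₆ (by clear * - hnd; grind) n36
  have p46 := path _ _ _ _ _ h₄ r₄ r₆ (by clear * - hnd; grind) n46
  have p47 := path _ _ _ _ _ h₄ r₄ r₇ (by clear * - hnd; grind) n47
  have p57 := path _ _ _ _ _ h₅ r₅ r₇ (by clear * - hnd; grind) n57
  have e01 : U.Adj v₀ v₁ := by simp [h₀]
  have e04 : U.Adj v₀ v₄ := by simp [h₀]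
  have e07 : U.Adj v₀ v₇ := by simp [h₀]
  have e12 : U.Adj v₁ v₂ := by simp [h₁]
  have e15 : U.Adj v₁ v₅ := by simp [h₁]
  have e23 : U.Adj v₂ v₃ := by simp [h₂]
  have e26 : U.Adj v₂ v₆ := by simp [h₂]
  have e34 : U.Adj v₃ v₄ := by simp [h₃]
  have e37 : U.Adj v₃ v₇ := by simp [h₃]
  have e45 : U.Adj v₄ v₅ := by simp [h₄]
  have e56 : U.Adj v₅ v₆ := by simp [h₅]
  have e67 : U.Adj v₆ v₇ := by simp [h₆]
  rw [hU] at n02 n03 n05 n06 n13 n14 n16 n17 n24 n25 n27 n35 n36 n46 n47 n57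
  rw [hU] at e01 e04 e07 e12 e15 e23 e26 e34 e37 e45 e56 e67
  have q01 : D v₁ v₀ ↔ ¬ D v₀ v₁ :=
    ⟨hD _ _, e01.resolve_left⟩
  have q04 : D v₄ v₀ ↔ ¬ D v₀ v₄ :=
    ⟨hD _ _, e04.resolve_left⟩
  have q07 : D v₇ v₀ ↔ ¬ D v₀ v₇ :=
    ⟨hD _ _, e07.resolve_left⟩
  have q12 : D v₂ v₁ ↔ ¬ D v₁ v₂ :=
    ⟨hD _ _, e12.resolve_left⟩
  have q15 : D v₅ v₁ ↔ ¬ D v₁ v₅ :=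
    ⟨hD _ _, e15.resolve_left⟩
  have q23 : D v₃ v₂ ↔ ¬ D v₂ v₃ :=
    ⟨hD _ _, e23.resolve_left⟩
  have q26 : D v₆ v₂ ↔ ¬ D v₂ v₆ :=
    ⟨hD _ _, e26.resolve_left⟩
  have q34 : D v₄ v₃ ↔ ¬ D v₃ v₄ :=
    ⟨hD _ _, e34.resolve_left⟩
  have q37 : D v₇ v₃ ↔ ¬ D v₃ v₇ :=
    ⟨hD _ _, e37.resolve_left⟩
  have q45 : D v₅ v₄ ↔ ¬ D v₄ v₅ :=
    ⟨hD _ _, e45.resolve_left⟩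
  have q56 : D v₆ v₅ ↔ ¬ D v₅ v₆ :=
    ⟨hD _ _, e56.resolve_left⟩
  have q67 : D v₇ v₆ ↔ ¬ D v₆ v₇ :=
    ⟨hD _ _, e67.resolve_left⟩
  rw [not_or] at n02 n03 n05 n06 n13 n14 n16 n17 n24 n25 n27 n35 n36 n46 n47 n57
  simp only [n03, n06, n13, n14, n16, n17, n24, n25, n27, n35, n36, n46, n47, n57,
    q01, q04, q07, q12, q15, q23, q26, q34,
    q37, q45, q56, q67,
    and_false, false_and, or_false, false_or] at p02 p03 p05 p06 p13 p14 p16 p17 p24 p25 p27 p35 p36 p46 p47 p57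
  clear * - p02 p03 p05 p06 p13 p14 p16 p17 p24 p25 p27 p35 p36 p46 p47 p57
  generalize D v₀ v₁ = x01 at *
  generalize D v₀ v₄ = x04 at *
  generalize D v₀ v₇ = x07 at *
  generalize D v₁ v₂ = x12 at *
  generalize D v₁ v₅ = x15 at *
  generalize D v₂ v₃ = x23 at *
  generalize D v₂ v₆ = x26 at *
  generalize D v₃ v₄ = x34 at *
  generalize D v₃ v₇ = x37 at *
  generalize D v₄ v₅ = x45 at *
  generalize D v₅ v₆ = x56 at *
  generalize D v₆ v₇ = x67 at *
  -- The orientation is now twelve propositional variables, one for each edge.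
  grind

end SimpleGraph

/-! ### Transfer to coloured mixed graphs, and the theorem -/

namespace MNGraph

theorem degree_le_of_maxDegreeLE {V : Type} {U : SimpleGraph V} {Δ : ℕ} (h : MaxDegreeLE Δ V U)
    (v : V) [Fintype (U.neighborSet v)] : U.degree v ≤ Δ := by
  have := h v
  rw [← SimpleGraph.coe_neighborFinset, Set.encard_coe_eq_coe_finsetCard,
    SimpleGraph.card_neighborFinset_eq_degree] at this
  exact_mod_cast this

theorem und_castLE {m₀ n₀ m n : ℕ} {V : Type} (hm : m₀ ≤ m) (hn : n₀ ≤ n) (G : MNGraph m₀ n₀ V) :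
    (G.castLE hm hn).und = G.und := by
  ext u v
  simp [und, castLE]

/-- Vertices that see each other are adjacent or have a common neighbour. -/
theorem Sees.adj_or {m n : ℕ} {V : Type} {G : MNGraph m n V} {u v : V} (h : G.Sees u v) :
    G.und.Adj u v ∨ ∃ w, G.und.Adj u w ∧ G.und.Adj w v :=
  h.imp id fun ⟨w, h1, h2, _⟩ => ⟨w, G.label_ne_none_symm h1, h2⟩

theorem card_le_ten {m n : ℕ} {V : Type} [Finite V] (G : MNGraph m n V)
    (hG : MaxDegreeLE 3 V G.und) (R : Finset V)
    (hs : ∀ u ∈ R, ∀ v ∈ R, u ≠ v → G.Sees u v) : R.card ≤ 10 := by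
  classical
  have := Fintype.ofFinite V
  rcases R.eq_empty_or_nonempty with rfl | ⟨u, hu⟩
  · simp
  · have h1 := G.und.card_le_of_adj_or_common_neighbor (fun v => degree_le_of_maxDegreeLE hG v) R u
      fun v hv hvu => (hs u hu v hv hvu.symm).adj_or
    have h2 := degree_le_of_maxDegreeLE hG u
    omega

/-- The colour of the edge joining two vertices, or `0`. -/
def edgeColour {V : Type} (G : MNGraph 0 3 V) (u v : V) : Fin 3 :=
  match G.label u v with
  | some (.edge j) => j
  | _ => 0

/-- Seeing passes to subsets, so it suffices to exclude nine vertices. Without arcs a label is just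
a colour, so different labels at a vertex are different colours. -/
theorem card_le_eight_of_edge_coloured {n : ℕ} (hn : n ≤ 3) {V : Type} [Finite V]
    (G : MNGraph 0 n V) (hG : MaxDegreeLE 3 V G.und) (R : Finset V)
    (hs : ∀ u ∈ R, ∀ v ∈ R, u ≠ v → G.Sees u v) : R.card ≤ 8 := by
  classical
  have := Fintype.ofFinite V
  by_contra hlt
  obtain ⟨S, hSR, hS⟩ := Finset.exists_subset_card_eq (show 9 ≤ R.card by omega)
  let H : MNGraph 0 3 V := G.castLE le_rfl hn
  have hH : MaxDegreeLE 3 V H.und := by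
    rw [und_castLE]
    exact hG
  have hcol : ∀ u v, H.edgeColour u v = H.edgeColour v u := by
    intro u v
    unfold edgeColour
    rw [H.label_rev u v]
    rcases H.label u v with _ | (i | i | j)
    · rfl
    · exact i.elim0
    · exact i.elim0
    · rfl
  refine SimpleGraph.card_ne_nine_of_colSees (U := H.und) (fun v => degree_le_of_maxDegreeLE hH v) hcol
    (R := S) (fun u hu v hv huv => ?_) hS
  rcases castLE_sees le_rfl hn G (hs u (hSR hu) v (hSR hv) huv) with h | ⟨w, h1, h2, h3⟩
  · exact Or.inl h
  · refine Or.inr ⟨w, h1, h2, fun he => h3 ?_⟩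
    change H.label w u ≠ none at h1
    change H.label w v ≠ none at h2
    change H.label w u = H.label w v
    unfold edgeColour at he
    revert h1 h2 he
    rcases H.label w u with _ | (i | i | j) <;> rcases H.label w v with _ | (i' | i' | j')
    all_goals first | exact i.elim0 | exact i'.elim0 | simp

/-- With one arc colour, different labels at `w` mean one arc in and one arc out, that is, a
directed path through `w`. -/
theorem card_le_seven_of_oriented {V : Type} [Finite V]
    (G : MNGraph 1 0 V) (hG : MaxDegreeLE 3 V G.und) (R : Finset V)
    (hs : ∀ u ∈ R, ∀ v ∈ R, u ≠ v → G.Sees u v) : R.card ≤ 7 := by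
  classical
  have := Fintype.ofFinite V
  by_contra hlt
  obtain ⟨S, hSR, hS⟩ := Finset.exists_subset_card_eq (show 8 ≤ R.card by omega)
  have hcases : ∀ u v, G.label u v ≠ none →
      G.label u v = some (.fwd 0) ∧ G.label v u = some (.bwd 0) ∨
        G.label u v = some (.bwd 0) ∧ G.label v u = some (.fwd 0) := by
    intro u v h
    rw [G.label_rev u v]
    revert h
    rcases G.label u v with _ | (i | i | j)
    · simp
    · simp [AdjType.rev, Subsingleton.elim i 0]
    · simp [AdjType.rev, Subsingleton.elim i 0]
    · exact j.elim0
  refine SimpleGraph.card_ne_eight_of_dirSees (U := G.und) (fun v => degree_le_of_maxDegreeLE hG v)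
    (D := fun u v => G.label u v = some (.fwd 0)) (fun u v h1 h2 => ?_) (fun u v => ?_)
    (R := S) (fun u hu v hv huv => ?_) hS
  · rw [G.label_rev u v, h1] at h2
    simp [AdjType.rev] at h2
  · constructor
    · intro h
      exact (hcases u v h).imp And.left And.right
    · rintro (h | h)
      · change G.label u v ≠ none
        simp [h]
      · refine G.label_ne_none_symm (u := v) ?_
        simp [h]
  · rcases hs u (hSR hu) v (hSR hv) huv with h | ⟨w, h1, h2, h3⟩
    · exact Or.inl h
    · refine Or.inr ⟨w, ?_⟩
      rcases hcases w u h1 with ⟨h4, h5⟩ | ⟨h4, h5⟩ <;>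
        rcases hcases w v h2 with ⟨h6, h7⟩ | ⟨h6, h7⟩
      · exact absurd (h4.trans h6.symm) h3
      · exact Or.inr ⟨h7, h4⟩
      · exact Or.inl ⟨h5, h6⟩
      · exact absurd (h4.trans h6.symm) h3

end MNGraph

theorem mainTheorem4 :
    (FamilyAbsoluteCliqueNumberEq 1 0 (MaxDegreeLE 3) 7 ∧
      FamilyRelativeCliqueNumberEq 1 0 (MaxDegreeLE 3) 7) ∧
    (∀ n : ℕ, n = 2 ∨ n = 3 →
      FamilyAbsoluteCliqueNumberEq 0 n (MaxDegreeLE 3) 8 ∧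
      FamilyRelativeCliqueNumberEq 0 n (MaxDegreeLE 3) 8) ∧
    (∀ m n : ℕ, (m = 1 ∧ n = 1) ∨ 4 ≤ 2 * m + n →
      FamilyAbsoluteCliqueNumberEq m n (MaxDegreeLE 3) 10 ∧
      FamilyRelativeCliqueNumberEq m n (MaxDegreeLE 3) 10) := by
  refine ⟨?_, fun n hn => ?_, fun m n h => ?_⟩
  · exact family_cliqueNumber_eq 1 0 7 _ (fun V _ G hG R hs => card_le_seven_of_oriented G hG R hs)
      (exists_oriented_clique le_rfl)
  · exact family_cliqueNumber_eq 0 n 8 _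
      (fun V _ G hG R hs => card_le_eight_of_edge_coloured (by omega) G hG R hs)
      (exists_two_edge_coloured_clique (by omega))
  · exact family_cliqueNumber_eq m n 10 _ (fun V _ G hG R hs => card_le_ten G hG R hs)
      (exists_petersen_clique h)
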